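/- **Setting.** Let $\mathcal K$ be an augmented virtual double category: it has objects, vertical morphisms $f\colon A\to C$ (forming a category), horizontal morphisms $J\colon A ⇸ B$, and cells $\varphi\colon \underline J\Rightarrow\underline K$ whose boundary consists of a vertical source $f\colon A\to C$, a vertical target $g\colon B\to D$, a horizontal source $\underline J\colon A ⇸ B$ which is a (possibly empty) path of horizontal morphisms, and a horizontal target $\underline K\colon C ⇸ D$ which is a path of length $0$ (*nullary* cells) or $1$ (*unary* cells). A path of cells, whose vertical boundaries match, can be composed with a cell whose horizontal source is the concatenation of the horizontal targets of the path; this composition is associative and unital, with horizontal identity cells $\mathrm{id}_J\colon J\Rightarrow J$ and vertical identity cells $\mathrm{id}_f$. A nullary cell with empty target at $M$ is written $\underline J\Rightarrow M$, and $\eta\odot\zeta$ is the horizontal composite of nullary cells. A unary cell is *horizontal* if its vertical source and target are identities. **Cartesian cells.** A cell $\psi\colon J\Rightarrow\underline K$, with vertical boundary $f,g$ and with $J$ a single morphism, is *cartesian* if every cell $\underline H\Rightarrow\underline K$ with vertical boundary $f\circ h$, $g\circ k$ factors uniquely as $\psi\circ\chi'$, with $\chi'\colon\underline H\Rightarrow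 J$ having vertical boundary $h,k$; then $J$ is the *restriction* $\underline K(f,g)$, which is *nullary* if $\underline K=C$ is empty and *unary* otherwise. $\mathcal K$ is *unital* if the restrictions $C(\mathrm{id},\mathrm{id})$ exist for all objects $C$; it has *restrictions on the left* if all unary restrictions $K(f,\mathrm{id})$ exist. The *companion* of $f\colon A\to C$ is $f_*=C(f,\mathrm{id})$. **Left Kan extensions.** A nullary cell $\eta\colon\underline J\Rightarrow M$, with vertical boundary $d\colon A\to M$, $l\colon B\to M$, is *left Kan* if for every path $\underline H\colon B ⇸ C$ every nullary cell $\underline J^\frown\underline H\Rightarrow M$ with vertical source $d$ factors uniquely as $\eta\odot\zeta$; it is *weakly left Kan* if this holds for $\underline H$ empty. Then $l$ is the *(weak) left Kan extension* of $d$ along $\underline J$. If $\underline J=(J_1,\dots,J_n)$ with $n\ge1$ then $\eta$ is *pointwise* (weakly) left Kan if it is (weakly) left Kan and $\eta\circ(\mathrm{id},\dots,\mathrm{id},\mathrm{cart})$ is (weakly) left Kan for each cartesian cell $\mathrm{cart}$ that defines a restriction $J_n(\mathrm{id},f)$. **Yoneda morphisms.** $y\colon A\to P$ is a *Yoneda morphism*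 if it is dense, i.e. cartesian nullary cells $J\Rightarrow P$ with vertical source $y$ are left Kan, and for each $J\colon A ⇸ B$ there are a morphism $J^\lambda\colon B\to P$ and a cartesian cell $J\Rightarrow P$ with vertical boundary $y$, $J^\lambda$. It *admits nullary restrictions* if the restriction $P(y,g)$ exists for all $g\colon B\to P$. **Cocartesian cells.** A path $\underline\varphi$ of cells with vertical boundary $f,g$ is *weakly unary-cocartesian* (respectively *weakly nullary-cocartesian*) if every unary (respectively nullary) cell whose horizontal source is that of $\underline\varphi$ and whose vertical boundary is of the form $h\circ f$, $k\circ g$ factors uniquely as $\chi'\circ\underline\varphi$, with $\chi'$ having vertical boundary $h,k$. It is *right* unary- (nullary-)cocartesian if $\underline\varphi$ itself and all paths $\underline\varphi^\frown(\mathrm{cart},\mathrm{id},\dots,\mathrm{id})$, with $\mathrm{cart}$ a cartesian cell defining a restriction $K_1(g,\mathrm{id})$ and $\mathrm{id},\dots,\mathrm{id}$ any number ($\geq 0$) of horizontal identity cells, are weakly unary- (nullary-)cocartesian. It is *right (respectively weakly) cocartesian* if it is both right (respectively weakly) unary- and nullary-cocartesian. A cell $\varphi$ is *cocartesian* if all paths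 obtained from it by optionally extending on the right as above and, dually, optionally extending on the left by $(\mathrm{id},\dots,\mathrm{id},\mathrm{cart})$ with $\mathrm{cart}$ defining a restriction $K_p(\mathrm{id},f)$, are weakly unary- and weakly nullary-cocartesian. The *horizontal composite* of a path $\underline J$ exists if there is a horizontal cocartesian cell $\underline J\Rightarrow K$. Now let $\varphi\colon(J_1,\dots,J_n)\Rightarrow K$ be a horizontal cell with $n\ge1$ and with target $K\colon A_0 ⇸ A_n$. For each $f\colon Y\to A_n$ for which $J_n(\mathrm{id},f)$ and $K(\mathrm{id},f)$ exist let $\varphi'_f$ be the factorisation of $\varphi\circ(\mathrm{id},\dots,\mathrm{id},\mathrm{cart})$ through the cartesian cell defining $K(\mathrm{id},f)$. Then $\varphi$ is *pointwise right (respectively weakly) (unary-)cocartesian* if it is right (respectively weakly) (unary-)cocartesian and, for each $f$ such that $J_n(\mathrm{id},f)$ exists, $K(\mathrm{id},f)$ exists and $\varphi'_f$ is right (respectively weakly) (unary-)cocartesian. It is *right pointwise cocartesian* if each $\varphi'_f$, for $f$ such that both restrictions exist, is cocartesian. **Exact cells.** A cell $\varphi$ with target $K\colon C ⇸ D$ is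 *(weakly) left $d$-exact*, for $d\colon C\to M$, if $\eta\circ\varphi$ is (weakly) left Kan for each (weakly) left Kan cell $\eta\colon K\Rightarrow M$ with vertical source $d$; it is *pointwise* (weakly) left $d$-exact if the same holds with "left Kan" replaced by "pointwise left Kan". **Theorem.** Let $J\colon A ⇸ B$ be a horizontal morphism, let $\underline H=(H_1,\dots,H_n)\colon B ⇸ B_n$ be a path of length $n\ge1$, and let $y_A\colon A\to\widehat A$ be a Yoneda morphism. Choose $J^\lambda\colon B\to\widehat A$ with a cartesian cell $J\Rightarrow\widehat A$ with vertical boundary $y_A,J^\lambda$. Consider the following conditions. (a) The horizontal composite $(J\odot H_1\odot\dots\odot H_n)$ exists, that is, a cocartesian cell of the form below exists; (b) a right (respectively weakly) cocartesian horizontal cell $\varphi\colon(J,H_1,\dots,H_n)\Rightarrow K$ exists, for some $K\colon A ⇸ B_n$; (c) a right (respectively weakly) unary-cocartesian horizontal cell of this form exists; (d) a (weakly) left $y_A$-exact horizontal cell of this form exists; (e) the (weak) left Kan extension of $J^\lambda$ along $\underline H$ exists. Both in the full and in the weak version of these conditions the following hold. 1. (a) ⇒ (b) ⇒ (c) and (b)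 ⇒ (d) ⇒ (e). 2. If $\mathcal K$ is unital then (b) ⇔ (c). 3. If $\mathcal K$ has restrictions on the left then (d) ⇒ (c); if moreover $y_A$ admits nullary restrictions or the companion $y_{A*}$ exists then (c) ⇔ (d). 4. If $y_A$ admits nullary restrictions then (d) ⇔ (e). The same implications, under the same conditions, hold for the pointwise variants of (a)–(e) (where "cocartesian" in (a) becomes "right pointwise cocartesian", and the other notions are replaced by their pointwise versions defined above), except that (a) ⇒ (b) moreover requires of the cell $\varphi\colon(J,\underline H)\Rightarrow K$ in (a) that the restrictions $K(\mathrm{id},g)$ exist for all $g\colon X\to B_n$, and that the implications between (c) and (d) in 3 hold for cells with a given target $K$ for which the restrictions $K(\mathrm{id},g)$ exist for all $g\colon X\to B_n$. Finally, let $y_B\colon B\to\widehat B$ be a Yoneda morphism whose companion $y_{B*}$ exists. If the pointwise (weak) left Kan extension of $J^\lambda$ along $y_{B*}$ exists then, for each $H_1\colon B ⇸ B_1$, the pointwise (weak) left Kan extension of $J^\lambda$ along $H_1$ exists. -/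

import Mathlib

open CategoryTheory

universe t w v u

set_option linter.checkUnivs false

namespace AVDC

/-- Paths of composable horizontal morphisms. The path `nil A` is the empty path at `A`. -/
inductive HPath {O : Type u} (Hor : O → O → Type w) : O → O → Type (max u w)
  | nil (A : O) : HPath Hor A A
  | cons {A B C : O} (J : Hor A B) (p : HPath Hor B C) : HPath Hor A C

namespace HPath

variable {O : Type u} {Hor : O → O → Type w}

/-- Concatenation of paths. -/
def append {A B C : O} : HPath Hor A B → HPath Hor B C → HPath Hor A C
  | nil _, q => q
  | cons J p, q => cons J (append p q)

/-- The path consisting of one morphism. -/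
abbrev single {A B : O} (J : Hor A B) : HPath Hor A B := cons J (nil B)

/-- The path `p` followed by one more morphism `J`. -/
abbrev snoc {A B C : O} (p : HPath Hor A B) (J : Hor B C) : HPath Hor A C :=
  append p (single J)

/-- The length of a path. -/
def length {A B : O} : HPath Hor A B → ℕ
  | nil _ => 0
  | cons _ p => p.length + 1

@[simp] theorem nil_append {A B : O} (q : HPath Hor A B) : (nil A).append q = q := rfl

@[simp] theorem cons_append {A B C D : O} (J : Hor A B) (p : HPath Hor B C)
    (q : HPath Hor C D) : (cons J p).append q = cons J (p.append q) := rfl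

@[simp] theorem append_nil {A B : O} (p : HPath Hor A B) : p.append (nil B) = p := by
  induction p with
  | nil => rfl
  | cons J p ih => simp [ih]

@[simp] theorem append_assoc {A B C D : O} (p : HPath Hor A B) (q : HPath Hor B C)
    (r : HPath Hor C D) : (p.append q).append r = p.append (q.append r) := by
  induction p with
  | nil => rfl
  | cons J p ih => simp [ih]

end HPath

/-- The underlying graph of an augmented virtual double category: a category of objects and
vertical morphisms, horizontal morphisms, and cells. A cell `φ : Cell A B C D` has as boundary
a vertical source `left φ : A ⟶ C`, a vertical target `right φ : B ⟶ D`, a horizontal source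
`src φ`, which is a path from `A` to `B`, and a horizontal target `tgt φ`, which is a path from
`C` to `D` of length at most one. -/
class DoubleGraph (𝒦 : Type u) extends Category.{v} 𝒦 where
  Hor : 𝒦 → 𝒦 → Type w
  Cell : 𝒦 → 𝒦 → 𝒦 → 𝒦 → Type t
  left : ∀ {A B C D : 𝒦}, Cell A B C D → (A ⟶ C)
  right : ∀ {A B C D : 𝒦}, Cell A B C D → (B ⟶ D)
  src : ∀ {A B C D : 𝒦}, Cell A B C D → HPath Hor A B
  tgt : ∀ {A B C D : 𝒦}, Cell A B C D → HPath Hor C D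
  tgt_length : ∀ {A B C D : 𝒦} (φ : Cell A B C D), (tgt φ).length ≤ 1

open DoubleGraph (Hor Cell left right src tgt)

section Graph

variable {𝒦 : Type u} [DoubleGraph.{t, w, v} 𝒦]

/-- Paths of horizontal morphisms of `𝒦`. -/
abbrev HorPath (A B : 𝒦) := HPath (Hor (𝒦 := 𝒦)) A B

/-- Paths of cells with vertical source `f` and vertical target `g`, in which the vertical target
of each cell is the vertical source of the next. -/
inductive CellPath : {A C : 𝒦} → (A ⟶ C) → {B D : 𝒦} → (B ⟶ D) → Type (max t u v)
  | nil {A C : 𝒦} (f : A ⟶ C) : CellPath f f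
  | cons {A B C D E F : 𝒦} {f : A ⟶ C} {g : B ⟶ D} {h : E ⟶ F} (φ : Cell A B C D)
      (hl : left φ = f) (hr : right φ = g) (φs : CellPath g h) : CellPath f h

namespace CellPath

variable {A B C D E F : 𝒦}

/-- The concatenation of the horizontal sources. -/
def src {A C : 𝒦} {f : A ⟶ C} {B D : 𝒦} {g : B ⟶ D} : CellPath f g → HorPath A B
  | nil _ => HPath.nil _
  | cons φ _ _ φs => (DoubleGraph.src φ).append φs.src

/-- The concatenation of the horizontal targets. -/
def tgt {A C : 𝒦} {f : A ⟶ C} {B D : 𝒦} {g : B ⟶ D} : CellPath f g → HorPath C D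
  | nil _ => HPath.nil _
  | cons φ _ _ φs => (DoubleGraph.tgt φ).append φs.tgt

/-- Concatenation of paths of cells. -/
def append {A C : 𝒦} {f : A ⟶ C} {B D : 𝒦} {g : B ⟶ D} {E F : 𝒦} {h : E ⟶ F} :
    CellPath f g → CellPath g h → CellPath f h
  | nil _, ψs => ψs
  | cons φ hl hr φs, ψs => cons φ hl hr (append φs ψs)

/-- The path consisting of one cell. -/
def single {f : A ⟶ C} {g : B ⟶ D} (φ : Cell A B C D) (hl : left φ = f) (hr : right φ = g) :
    CellPath f g := cons φ hl hr (nil g)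

@[simp] theorem src_nil (f : A ⟶ C) : (nil f).src = HPath.nil A := rfl

@[simp] theorem tgt_nil (f : A ⟶ C) : (nil f).tgt = HPath.nil C := rfl

@[simp] theorem src_cons {f : A ⟶ C} {g : B ⟶ D} {h : E ⟶ F} (φ : Cell A B C D)
    (hl : left φ = f) (hr : right φ = g) (φs : CellPath g h) :
    (cons φ hl hr φs).src = (DoubleGraph.src φ).append φs.src := rfl

@[simp] theorem tgt_cons {f : A ⟶ C} {g : B ⟶ D} {h : E ⟶ F} (φ : Cell A B C D)
    (hl : left φ = f) (hr : right φ = g) (φs : CellPath g h) :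
    (cons φ hl hr φs).tgt = (DoubleGraph.tgt φ).append φs.tgt := rfl

@[simp] theorem src_single {f : A ⟶ C} {g : B ⟶ D} (φ : Cell A B C D) (hl : left φ = f)
    (hr : right φ = g) : (single φ hl hr).src = DoubleGraph.src φ := by
  simp [single]

@[simp] theorem tgt_single {f : A ⟶ C} {g : B ⟶ D} (φ : Cell A B C D) (hl : left φ = f)
    (hr : right φ = g) : (single φ hl hr).tgt = DoubleGraph.tgt φ := by
  simp [single]

@[simp] theorem src_append {f : A ⟶ C} {g : B ⟶ D} {h : E ⟶ F} (φs : CellPath f g)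
    (ψs : CellPath g h) : (φs.append ψs).src = φs.src.append ψs.src := by
  induction φs with
  | nil => rfl
  | cons φ hl hr φs ih => simp [append, ih]

@[simp] theorem tgt_append {f : A ⟶ C} {g : B ⟶ D} {h : E ⟶ F} (φs : CellPath f g)
    (ψs : CellPath g h) : (φs.append ψs).tgt = φs.tgt.append ψs.tgt := by
  induction φs with
  | nil => rfl
  | cons φ hl hr φs ih => simp [append, ih]

end CellPath

/-- The cells with a given boundary: vertical source `f`, horizontal source `J`, horizontal target
`K` and vertical target `g`. -/
@[ext]
structure CellOf {A B C D : 𝒦} (f : A ⟶ C) (J : HorPath A B) (K : HorPath C D) (g : B ⟶ D) where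
  cell : Cell A B C D
  left_eq : left cell = f
  right_eq : right cell = g
  src_eq : src cell = J
  tgt_eq : tgt cell = K

attribute [simp] CellOf.left_eq CellOf.right_eq CellOf.src_eq CellOf.tgt_eq

end Graph

/-- The operations of an augmented virtual double category: horizontal identity cells, vertical
identity cells, and the vertical composite of a path of cells with a cell. The path of cells is
allowed to be empty; the identity laws of `AugmentedVirtualDoubleCategory` reduce this case to
that of the path consisting of a vertical identity cell. -/
class DoubleOps (𝒦 : Type u) extends DoubleGraph.{t, w, v} 𝒦 where
  hid : ∀ {A B : 𝒦} (J : Hor A B), CellOf (𝟙 A) (HPath.single J) (HPath.single J) (𝟙 B)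
  vid : ∀ {A C : 𝒦} (f : A ⟶ C), CellOf f (HPath.nil A) (HPath.nil C) f
  compose : ∀ {A B C D E F : 𝒦} {f : A ⟶ C} {g : B ⟶ D} (φs : CellPath f g) (ψ : Cell C D E F),
    φs.tgt = src ψ → Cell A B E F
  left_compose : ∀ {A B C D E F : 𝒦} {f : A ⟶ C} {g : B ⟶ D} (φs : CellPath f g)
    (ψ : Cell C D E F) (h : φs.tgt = src ψ), left (compose φs ψ h) = f ≫ left ψ
  right_compose : ∀ {A B C D E F : 𝒦} {f : A ⟶ C} {g : B ⟶ D} (φs : CellPath f g)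
    (ψ : Cell C D E F) (h : φs.tgt = src ψ), right (compose φs ψ h) = g ≫ right ψ
  src_compose : ∀ {A B C D E F : 𝒦} {f : A ⟶ C} {g : B ⟶ D} (φs : CellPath f g)
    (ψ : Cell C D E F) (h : φs.tgt = src ψ), src (compose φs ψ h) = φs.src
  tgt_compose : ∀ {A B C D E F : 𝒦} {f : A ⟶ C} {g : B ⟶ D} (φs : CellPath f g)
    (ψ : Cell C D E F) (h : φs.tgt = src ψ), tgt (compose φs ψ h) = tgt ψ

open DoubleOps (hid vid compose)

attribute [simp] DoubleOps.left_compose DoubleOps.right_compose DoubleOps.src_compose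
  DoubleOps.tgt_compose

section Ops

variable {𝒦 : Type u} [DoubleOps.{t, w, v} 𝒦]

namespace CellPath

/-- The path of horizontal identity cells on a path of horizontal morphisms. -/
def ids {A B : 𝒦} : HorPath A B → CellPath (𝟙 A) (𝟙 B)
  | .nil _ => nil (𝟙 _)
  | .cons J p => cons (hid J).cell (hid J).left_eq (hid J).right_eq (ids p)

@[simp] theorem src_ids {A B : 𝒦} (p : HorPath A B) : (ids p).src = p := by
  induction p with
  | nil => rfl
  | cons J p ih => simp [ids, ih, (hid J).src_eq]

@[simp] theorem tgt_ids {A B : 𝒦} (p : HorPath A B) : (ids p).tgt = p := by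
  induction p with
  | nil => rfl
  | cons J p ih => simp [ids, ih, (hid J).tgt_eq]

end CellPath

/-! ### Composites of cells with given boundaries -/

namespace CellPath

/-- The vertical composite of a path of cells with a cell, with its boundary. -/
def compOf {A B C D E F : 𝒦} {f : A ⟶ C} {g : B ⟶ D} (φs : CellPath f g) {h : C ⟶ E}
    {L : HorPath E F} {k : D ⟶ F} (ψ : CellOf h φs.tgt L k) :
    CellOf (f ≫ h) φs.src L (g ≫ k) :=
  ⟨compose φs ψ.cell ψ.src_eq.symm,
    by simp [ψ.left_eq], by simp [ψ.right_eq], by simp, by simp [ψ.tgt_eq]⟩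

/-- The path consisting of one cell of given boundary. -/
abbrev of {A B C D : 𝒦} {f : A ⟶ C} {J : HorPath A B} {K : HorPath C D} {g : B ⟶ D}
    (φ : CellOf f J K g) : CellPath f g := single φ.cell φ.left_eq φ.right_eq

end CellPath

namespace CellOf

/-- The vertical composite `ψ ∘ φ` of two single cells. -/
def vcomp {A B C D E F : 𝒦} {f : A ⟶ C} {J : HorPath A B} {K : HorPath C D} {g : B ⟶ D} {h : C ⟶ E}
    {L : HorPath E F} {k : D ⟶ F} (ψ : CellOf h K L k) (φ : CellOf f J K g) :
    CellOf (f ≫ h) J L (g ≫ k) :=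
  ⟨compose (CellPath.of φ) ψ.cell (by simp [φ.tgt_eq, ψ.src_eq]),
    by simp [ψ.left_eq], by simp [ψ.right_eq], by simp [φ.src_eq], by simp [ψ.tgt_eq]⟩

/-- The horizontal composite `η ⊙ ζ` of two nullary cells. -/
def hcomp {A B C M : 𝒦} {d : A ⟶ M} {J : HorPath A B} {l : B ⟶ M} {H : HorPath B C} {k : C ⟶ M}
    (η : CellOf d J (HPath.nil M) l) (ζ : CellOf l H (HPath.nil M) k) :
    CellOf d (J.append H) (HPath.nil M) k :=
  ⟨compose ((CellPath.of η).append (CellPath.of ζ)) (vid (𝟙 M)).cell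
      (by simp [η.tgt_eq, ζ.tgt_eq, (vid (𝟙 M)).src_eq]),
    by simp [(vid (𝟙 M)).left_eq], by simp [(vid (𝟙 M)).right_eq],
    by simp [η.src_eq, ζ.src_eq], by simp [(vid (𝟙 M)).tgt_eq]⟩

/-- The composite `η ∘ (id, …, id, γ)`, in which only the last morphism of the horizontal source
of `η` is changed. -/
def precompLast {A B B' C D E : 𝒦} {d : A ⟶ C} {p : HorPath A E} {J : Hor E B} {L : HorPath C D}
    {l : B ⟶ D} (η : CellOf d (p.snoc J) L l) {J' : Hor E B'} {f : B' ⟶ B}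
    (γ : CellOf (𝟙 E) (HPath.single J') (HPath.single J) f) :
    CellOf d (p.snoc J') L (f ≫ l) :=
  ⟨compose ((CellPath.ids p).append (CellPath.of γ)) η.cell (by simp [γ.tgt_eq, η.src_eq]),
    by simp [η.left_eq], by simp [η.right_eq], by simp [γ.src_eq], by simp [η.tgt_eq]⟩

end CellOf

/-- A two-level configuration of cells: a path `(ψ₁, …, ψₙ)` of cells in which each `ψᵢ` comes
with a path `φs i` of cells that is vertically composable with it. -/
inductive Grid : {A C E : 𝒦} → (A ⟶ C) → (C ⟶ E) → {B D F : 𝒦} → (B ⟶ D) → (D ⟶ F) →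
    Type (max t u v)
  | nil {A C E : 𝒦} (f : A ⟶ C) (h : C ⟶ E) : Grid f h f h
  | cons {A C E B D F B' D' F' : 𝒦} {f : A ⟶ C} {h : C ⟶ E} {g : B ⟶ D} {k : D ⟶ F}
      {g' : B' ⟶ D'} {k' : D' ⟶ F'} (φs : CellPath f g) (ψ : Cell C D E F)
      (hs : φs.tgt = src ψ) (hl : left ψ = h) (hr : right ψ = k) (rest : Grid g k g' k') :
      Grid f h g' k'

namespace Grid

/-- The concatenation of the paths `φs i`. -/
def top {A C E : 𝒦} {f : A ⟶ C} {h : C ⟶ E} {B D F : 𝒦} {g : B ⟶ D} {k : D ⟶ F} :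
    Grid f h g k → CellPath f g
  | nil f _ => CellPath.nil f
  | cons φs _ _ _ _ rest => φs.append rest.top

/-- The path of cells `ψ i`. -/
def bot {A C E : 𝒦} {f : A ⟶ C} {h : C ⟶ E} {B D F : 𝒦} {g : B ⟶ D} {k : D ⟶ F} :
    Grid f h g k → CellPath h k
  | nil _ h => CellPath.nil h
  | cons _ ψ _ hl hr rest => CellPath.cons ψ hl hr rest.bot

/-- The path of the vertical composites of the `φs i` with the `ψ i`. -/
def composites {A C E : 𝒦} {f : A ⟶ C} {h : C ⟶ E} {B D F : 𝒦} {g : B ⟶ D} {k : D ⟶ F} :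
    Grid f h g k → CellPath (f ≫ h) (g ≫ k)
  | nil f h => CellPath.nil (f ≫ h)
  | cons φs ψ hs hl hr rest =>
    CellPath.cons (compose φs ψ hs) (by simp [hl]) (by simp [hr]) rest.composites

theorem bot_src {A C E : 𝒦} {f : A ⟶ C} {h : C ⟶ E} {B D F : 𝒦} {g : B ⟶ D} {k : D ⟶ F}
    (G : Grid f h g k) : G.top.tgt = G.bot.src := by
  induction G with
  | nil => rfl
  | cons φs ψ hs hl hr rest ih => simp [top, bot, ih, hs]

theorem composites_tgt {A C E : 𝒦} {f : A ⟶ C} {h : C ⟶ E} {B D F : 𝒦} {g : B ⟶ D} {k : D ⟶ F}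
    (G : Grid f h g k) : G.composites.tgt = G.bot.tgt := by
  induction G with
  | nil => rfl
  | cons φs ψ hs hl hr rest ih => simp [composites, bot, ih]

end Grid

end Ops

/-- Augmented virtual double categories. -/
class AugmentedVirtualDoubleCategory (𝒦 : Type u) extends DoubleOps.{t, w, v} 𝒦 where
  /-- Associativity of vertical composition. -/
  compose_assoc : ∀ {A C E B D F X Y : 𝒦} {f : A ⟶ C} {h : C ⟶ E} {g : B ⟶ D} {k : D ⟶ F}
    (G : Grid f h g k) (χ : Cell E F X Y) (hχ : G.bot.tgt = src χ),
    compose G.composites χ (G.composites_tgt.trans hχ) =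
      compose G.top (compose G.bot χ hχ) (G.bot_src.trans (DoubleOps.src_compose G.bot χ hχ).symm)
  /-- Precomposing with horizontal identity cells changes nothing. -/
  ids_compose : ∀ {A B C D : 𝒦} (φ : Cell A B C D),
    compose (CellPath.ids (src φ)) φ (CellPath.tgt_ids (src φ)) = φ
  /-- Postcomposing a unary cell with a horizontal identity cell changes nothing. -/
  compose_hid : ∀ {A B C D : 𝒦} {f : A ⟶ C} {J : HorPath A B} {K : Hor C D} {g : B ⟶ D}
    (φ : CellOf f J (HPath.single K) g), ((hid K).vcomp φ).cell = φ.cell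
  /-- Postcomposing a nullary cell with a vertical identity cell on an identity morphism changes
  nothing. -/
  compose_vid : ∀ {A B C : 𝒦} {f : A ⟶ C} {J : HorPath A B} {g : B ⟶ C}
    (φ : CellOf f J (HPath.nil C) g), ((vid (𝟙 C)).vcomp φ).cell = φ.cell
  /-- Vertical identity cells can be inserted in, and removed from, paths of cells. -/
  insert_vid : ∀ {A C B D A' C' E F : 𝒦} {f : A ⟶ C} {g : B ⟶ D} {h : A' ⟶ C'}
    (φs : CellPath f g) (φs' : CellPath g h) (ψ : Cell C C' E F)
    (hψ : (φs.append φs').tgt = src ψ)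
    (hψ' : (φs.append (CellPath.cons (vid g).cell (vid g).left_eq (vid g).right_eq φs')).tgt = src ψ),
    compose (φs.append (CellPath.cons (vid g).cell (vid g).left_eq (vid g).right_eq φs')) ψ hψ' =
      compose (φs.append φs') ψ hψ
  /-- Vertical identity cells compose as the vertical morphisms do. -/
  vid_compose_vid : ∀ {A C E : 𝒦} (f : A ⟶ C) (h : C ⟶ E), (vid h).vcomp (vid f) = vid (f ≫ h)

variable {𝒦 : Type u} [AugmentedVirtualDoubleCategory.{t, w, v} 𝒦]

/-- Horizontal unary cells `J ⇒ K`, that is with identities as vertical source and target. -/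
abbrev HorCell {A B : 𝒦} (J : HorPath A B) (K : Hor A B) : Type t :=
  CellOf (𝟙 A) J (HPath.single K) (𝟙 B)

/-! ### Cartesian cells and restrictions -/

/-- Cartesian cells `ψ : J ⇒ K`. -/
def IsCartesian {A B C D : 𝒦} {f : A ⟶ C} {J : Hor A B} {K : HorPath C D} {g : B ⟶ D}
    (ψ : CellOf f (HPath.single J) K g) : Prop :=
  ∀ {X Y : 𝒦} (h : X ⟶ A) (k : Y ⟶ B) (H : HorPath X Y) (χ : CellOf (h ≫ f) H K (k ≫ g)),
    ∃! χ' : CellOf h H (HPath.single J) k, ψ.vcomp χ' = χ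

/-- The restriction `K(f, g)` exists. It is a nullary restriction if `K` is empty. -/
def HasRestriction {A B C D : 𝒦} (f : A ⟶ C) (K : HorPath C D) (g : B ⟶ D) : Prop :=
  ∃ (J : Hor A B) (ψ : CellOf f (HPath.single J) K g), IsCartesian ψ

/-- All restrictions `K(id, g)` of the horizontal morphism `K` exist. -/
def HasRightRestrictionsOf {C D : 𝒦} (K : Hor C D) : Prop :=
  ∀ {X : 𝒦} (g : X ⟶ D), HasRestriction (𝟙 C) (HPath.single K) g

variable (𝒦) in
/-- `𝒦` has restrictions on the left, that is all unary restrictions `K(f, id)`. -/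
def HasLeftRestrictions : Prop :=
  ∀ {X C D : 𝒦} (f : X ⟶ C) (K : Hor C D), HasRestriction f (HPath.single K) (𝟙 D)

variable (𝒦) in
/-- `𝒦` is unital: each object `C` has a horizontal unit, the nullary restriction `C(id, id)`. -/
def IsUnital : Prop :=
  ∀ C : 𝒦, HasRestriction (𝟙 C) (HPath.nil C) (𝟙 C)

/-- The nullary restrictions `P(y, g)` exist for all `g` into `P`. -/
def AdmitsNullaryRestrictions {A P : 𝒦} (y : A ⟶ P) : Prop :=
  ∀ {B : 𝒦} (g : B ⟶ P), HasRestriction y (HPath.nil P) g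

/-- The companion of `y` exists. -/
def HasCompanion {A P : 𝒦} (y : A ⟶ P) : Prop :=
  HasRestriction y (HPath.nil P) (𝟙 P)

/-! ### Left Kan extension -/

/-- Whether a notion is taken in its full or in its weak form. -/
inductive Strength
  | full
  | weak

/-- Each nullary cell with horizontal source `J ⌢ H`, and with the vertical source of `η`, factors
uniquely through `η : J ⇒ M` as a nullary cell with horizontal source `H`. -/
def FactorsUniquely {A B M : 𝒦} {d : A ⟶ M} {J : HorPath A B} {l : B ⟶ M}
    (η : CellOf d J (HPath.nil M) l) {C : 𝒦} (H : HorPath B C) : Prop :=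
  ∀ (k : C ⟶ M) (φ : CellOf d (J.append H) (HPath.nil M) k),
    ∃! φ' : CellOf l H (HPath.nil M) k, η.hcomp φ' = φ

/-- `η` is (weakly) left Kan. -/
def IsLeftKan (s : Strength) {A B M : 𝒦} {d : A ⟶ M} {J : HorPath A B} {l : B ⟶ M}
    (η : CellOf d J (HPath.nil M) l) : Prop :=
  match s with
  | .full => ∀ {C : 𝒦} (H : HorPath B C), FactorsUniquely η H
  | .weak => FactorsUniquely η (HPath.nil B)

/-- `η : p ⌢ (J) ⇒ M` is pointwise (weakly) left Kan: it is (weakly) left Kan and restricts along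
every `f` such that the restriction `J(id, f)` exists. -/
def IsPointwiseLeftKan (s : Strength) {A B E M : 𝒦} {d : A ⟶ M} (p : HorPath A E) (J : Hor E B)
    {l : B ⟶ M} (η : CellOf d (p.snoc J) (HPath.nil M) l) : Prop :=
  IsLeftKan s η ∧
    ∀ {X : 𝒦} (f : X ⟶ B) (J' : Hor E X)
      (γ : CellOf (𝟙 E) (HPath.single J') (HPath.single J) f),
      IsCartesian γ → IsLeftKan s (η.precompLast γ)

/-- The (weak) left Kan extension of `d` along `J` exists. -/
def LeftKanExtensionExists (s : Strength) {A B M : 𝒦} (d : A ⟶ M) (J : HorPath A B) : Prop :=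
  ∃ (l : B ⟶ M) (η : CellOf d J (HPath.nil M) l), IsLeftKan s η

/-- The pointwise (weak) left Kan extension of `d` along `p ⌢ (J)` exists. -/
def PointwiseLeftKanExtensionExists (s : Strength) {A B E M : 𝒦} (d : A ⟶ M) (p : HorPath A E)
    (J : Hor E B) : Prop :=
  ∃ (l : B ⟶ M) (η : CellOf d (p.snoc J) (HPath.nil M) l), IsPointwiseLeftKan s p J η

/-! ### Cocartesian cells -/

/-- `φs` is weakly nullary-cocartesian (`n = 0`) or weakly unary-cocartesian (`n = 1`). -/
def IsWeaklyCocartesian (n : ℕ) {A B C D : 𝒦} {f : A ⟶ C} {g : B ⟶ D} (φs : CellPath f g) :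
    Prop :=
  ∀ {E F : 𝒦} (h : C ⟶ E) (k : D ⟶ F) (L : HorPath E F), L.length = n →
    ∀ χ : CellOf (f ≫ h) φs.src L (g ≫ k), ∃! χ' : CellOf h φs.tgt L k, φs.compOf χ' = χ

/-- The paths by which a path of cells with vertical target `g` is extended on the right: the
empty path and the paths `(cart, id, …, id)` with `cart` defining a restriction `K(g, id)`. -/
inductive IsRightExtension {B D : 𝒦} (g : B ⟶ D) :
    {Y Z : 𝒦} → {k : Y ⟶ Z} → CellPath g k → Prop
  | nil : IsRightExtension g (CellPath.nil g)
  | cart {Z Y : 𝒦} (K : Hor D Z) (Ks : HorPath Z Y) (K' : Hor B Z)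
      (γ : CellOf g (HPath.single K') (HPath.single K) (𝟙 Z)) (hγ : IsCartesian γ) :
      IsRightExtension g (CellPath.cons γ.cell γ.left_eq γ.right_eq (CellPath.ids Ks))

/-- The paths by which a path of cells with vertical source `f` is extended on the left: the
empty path and the paths `(id, …, id, cart)` with `cart` defining a restriction `K(id, f)`. -/
inductive IsLeftExtension {A C : 𝒦} (f : A ⟶ C) :
    {Y Z : 𝒦} → {k : Y ⟶ Z} → CellPath k f → Prop
  | nil : IsLeftExtension f (CellPath.nil f)
  | cart {Z Y : 𝒦} (Ks : HorPath Y Z) (K : Hor Z C) (K' : Hor Z A)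
      (γ : CellOf (𝟙 Z) (HPath.single K') (HPath.single K) f) (hγ : IsCartesian γ) :
      IsLeftExtension f ((CellPath.ids Ks).append (CellPath.of γ))

/-- `φs` is right (respectively weakly) nullary-cocartesian (`n = 0`) or right (respectively weakly)
unary-cocartesian (`n = 1`). -/
def IsRightCocartesianFor (n : ℕ) (s : Strength) {A B C D : 𝒦} {f : A ⟶ C} {g : B ⟶ D}
    (φs : CellPath f g) : Prop :=
  match s with
  | .full => ∀ {Y Z : 𝒦} {k : Y ⟶ Z} (ζs : CellPath g k), IsRightExtension g ζs →
      IsWeaklyCocartesian n (φs.append ζs)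
  | .weak => IsWeaklyCocartesian n φs

/-- `φ` is right (respectively weakly) unary-cocartesian. -/
def IsRightUnaryCocartesian (s : Strength) {A B C D : 𝒦} {f : A ⟶ C} {J : HorPath A B}
    {K : HorPath C D} {g : B ⟶ D} (φ : CellOf f J K g) : Prop :=
  IsRightCocartesianFor 1 s (CellPath.of φ)

/-- `φ` is right (respectively weakly) cocartesian. -/
def IsRightCocartesian (s : Strength) {A B C D : 𝒦} {f : A ⟶ C} {J : HorPath A B}
    {K : HorPath C D} {g : B ⟶ D} (φ : CellOf f J K g) : Prop :=
  IsRightCocartesianFor 0 s (CellPath.of φ) ∧ IsRightCocartesianFor 1 s (CellPath.of φ)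

/-- `φ` is cocartesian: the extensions of `φ`, on both sides, are weakly cocartesian. The target of
a horizontal cocartesian cell `J ⇒ K` is the horizontal composite of `J`. -/
def IsCocartesian {A B C D : 𝒦} {f : A ⟶ C} {J : HorPath A B} {K : HorPath C D} {g : B ⟶ D}
    (φ : CellOf f J K g) : Prop :=
  ∀ {W X Y Z : 𝒦} {h : W ⟶ X} {k : Y ⟶ Z} (ξs : CellPath h f) (ζs : CellPath g k),
    IsLeftExtension f ξs → IsRightExtension g ζs →
      IsWeaklyCocartesian 0 (ξs.append ((CellPath.of φ).append ζs)) ∧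
        IsWeaklyCocartesian 1 (ξs.append ((CellPath.of φ).append ζs))

/-- `φ'` is a factorisation of `φ ∘ (id, …, id, γ)` through `κ`, where `γ` and `κ` define the
restrictions along `f` of the last morphism of the source and of the target of `φ`. -/
def IsRestrictionOf {A C D E Y : 𝒦} {a : A ⟶ C} {p : HorPath A E} {H : Hor E D} {K : Hor C D}
    (φ : CellOf a (p.snoc H) (HPath.single K) (𝟙 D)) {f : Y ⟶ D} {H' : Hor E Y} {K' : Hor C Y}
    (γ : CellOf (𝟙 E) (HPath.single H') (HPath.single H) f)
    (κ : CellOf (𝟙 C) (HPath.single K') (HPath.single K) f)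
    (φ' : CellOf a (p.snoc H') (HPath.single K') (𝟙 Y)) : Prop :=
  IsCartesian γ ∧ IsCartesian κ ∧ (φ.precompLast γ).cell = (κ.vcomp φ').cell

/-- `φ : p ⌢ (H) ⇒ K` is pointwise right (respectively weakly) cocartesian: it is right
(respectively weakly) cocartesian and restricts along every `f` such that `H(id, f)` exists. -/
def IsPointwiseRightCocartesian (s : Strength) {A C D E : 𝒦} {a : A ⟶ C} (p : HorPath A E)
    (H : Hor E D) {K : Hor C D} (φ : CellOf a (p.snoc H) (HPath.single K) (𝟙 D)) : Prop :=
  IsRightCocartesian s φ ∧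
    ∀ {Y : 𝒦} (f : Y ⟶ D), HasRestriction (𝟙 E) (HPath.single H) f →
      HasRestriction (𝟙 C) (HPath.single K) f ∧
        ∀ (H' : Hor E Y) (K' : Hor C Y)
          (γ : CellOf (𝟙 E) (HPath.single H') (HPath.single H) f)
          (κ : CellOf (𝟙 C) (HPath.single K') (HPath.single K) f)
          (φ' : CellOf a (p.snoc H') (HPath.single K') (𝟙 Y)),
          IsRestrictionOf φ γ κ φ' → IsRightCocartesian s φ'

/-- `φ : p ⌢ (H) ⇒ K` is pointwise right (respectively weakly) unary-cocartesian. -/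
def IsPointwiseRightUnaryCocartesian (s : Strength) {A C D E : 𝒦} {a : A ⟶ C} (p : HorPath A E)
    (H : Hor E D) {K : Hor C D} (φ : CellOf a (p.snoc H) (HPath.single K) (𝟙 D)) : Prop :=
  IsRightUnaryCocartesian s φ ∧
    ∀ {Y : 𝒦} (f : Y ⟶ D), HasRestriction (𝟙 E) (HPath.single H) f →
      HasRestriction (𝟙 C) (HPath.single K) f ∧
        ∀ (H' : Hor E Y) (K' : Hor C Y)
          (γ : CellOf (𝟙 E) (HPath.single H') (HPath.single H) f)
          (κ : CellOf (𝟙 C) (HPath.single K') (HPath.single K) f)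
          (φ' : CellOf a (p.snoc H') (HPath.single K') (𝟙 Y)),
          IsRestrictionOf φ γ κ φ' → IsRightUnaryCocartesian s φ'

/-- `φ : p ⌢ (H) ⇒ K` is right pointwise cocartesian: the factorisations `φ'` are cocartesian for
all `f` such that both restrictions `H(id, f)` and `K(id, f)` exist. -/
def IsPointwiseCocartesian {A C D E : 𝒦} {a : A ⟶ C} (p : HorPath A E) (H : Hor E D) {K : Hor C D}
    (φ : CellOf a (p.snoc H) (HPath.single K) (𝟙 D)) : Prop :=
  ∀ {Y : 𝒦} (f : Y ⟶ D) (H' : Hor E Y) (K' : Hor C Y)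
    (γ : CellOf (𝟙 E) (HPath.single H') (HPath.single H) f)
    (κ : CellOf (𝟙 C) (HPath.single K') (HPath.single K) f)
    (φ' : CellOf a (p.snoc H') (HPath.single K') (𝟙 Y)),
    IsRestrictionOf φ γ κ φ' → IsCocartesian φ'

/-! ### Exact cells and Yoneda morphisms -/

/-- `φ` is (weakly) left `d`-exact. -/
def IsLeftExact (s : Strength) {A B C D M : 𝒦} (d : C ⟶ M) {f : A ⟶ C} {J : HorPath A B}
    {K : HorPath C D} {g : B ⟶ D} (φ : CellOf f J K g) : Prop :=
  ∀ (l : D ⟶ M) (η : CellOf d K (HPath.nil M) l), IsLeftKan s η → IsLeftKan s (η.vcomp φ)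

/-- `φ : p ⌢ (H) ⇒ K` is pointwise (weakly) left `d`-exact. -/
def IsPointwiseLeftExact (s : Strength) {A B C D E M : 𝒦} (d : C ⟶ M) {f : A ⟶ C}
    (p : HorPath A E) (H : Hor E B) {K : Hor C D} {g : B ⟶ D}
    (φ : CellOf f (p.snoc H) (HPath.single K) g) : Prop :=
  ∀ (l : D ⟶ M) (η : CellOf d (HPath.single K) (HPath.nil M) l),
    IsPointwiseLeftKan s (HPath.nil C) K η → IsPointwiseLeftKan s p H (η.vcomp φ)

/-- `y : A ⟶ P` is dense: cartesian nullary cells with vertical source `y` are left Kan. -/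
def IsDense {A P : 𝒦} (y : A ⟶ P) : Prop :=
  ∀ {B : 𝒦} (J : Hor A B) (l : B ⟶ P) (η : CellOf y (HPath.single J) (HPath.nil P) l),
    IsCartesian η → IsLeftKan .full η

/-- `y : A ⟶ P` is a Yoneda morphism: it is dense, and each `J : A ⇸ B` is the nullary
restriction of `P` along `y` and some `B ⟶ P`. -/
def IsYoneda {A P : 𝒦} (y : A ⟶ P) : Prop :=
  IsDense y ∧ ∀ {B : 𝒦} (J : Hor A B),
    ∃ (l : B ⟶ P) (η : CellOf y (HPath.single J) (HPath.nil P) l), IsCartesian η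

end AVDC

open AVDC
open DoubleGraph (Hor)

/-! The proof turns on two ways of reading a nullary cell with vertical source `y`, where `y` is a
Yoneda morphism. Every horizontal `K` out of its domain is the source of a cartesian cell `η : K ⇒
P` with vertical source `y`; by cartesianness `η` converts unary cells into `K` to nullary cells
into `P`, and by density it is left Kan.

Exactness and Kan extension. As the cartesian cell of `J` is left Kan, a composite `η ∘ φ` with
source `J ⌢ H` is `cartJ ⊙ ζ` for a unique `ζ`, and by the pasting lemma `IsLeftKan.hcomp_iff` it is
left Kan exactly when `ζ` is. So an exact `φ` yields a Kan extension of `J^λ` along `H`. Conversely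
a Kan cell `ζ` with vertical target `l` yields `φ`, by factoring `cartJ ⊙ ζ` through `P(y, l)`. This
`φ` is exact because Kan cells are unique up to an invertible vertical cell
(`IsLeftKan.vcomp_congr`).

Exactness and cocartesianness. Factoring through `η ∘ φ` amounts to factoring through `φ`, extended
by identities, and then through `η`. If `η` is left Kan, factorisation of nullary cells through `φ`
therefore makes `η ∘ φ` left Kan (`IsLeftKan.vcomp_of_factorsThrough`), and conversely
(`IsLeftKan.factorsThrough_of_vcomp`). Unary and nullary cells are exchanged by
`FactorsThrough.of_cartesian` and `FactorsThrough.to_cartesian`: factoring cells into `L` is the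
same as factoring cells into a restriction of `L`. Units, nullary restrictions, the companion and
left restrictions enter only as sources of such restrictions.

The pointwise variants follow because these constructions commute with restricting the last
horizontal morphism, and because restrictions of cartesian cells are cartesian. For the last
assertion, every `H₁` is a restriction of the companion of `y_B`, so a pointwise Kan extension along
the companion restricts to one along `H₁`. -/

/-! ### The calculus of cells: congruence, associativity, interchange -/

section Calculus

open DoubleGraph (Cell left right src tgt)
open DoubleOps (hid vid compose)

namespace AVDC

/-! ### Equality of paths of cells up to their indices -/

namespace CellPath

section Graph

variable {𝒦 : Type u} [DoubleGraph.{t, w, v} 𝒦]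

@[simp] theorem append_nil {A B C D : 𝒦} {f : A ⟶ C} {g : B ⟶ D} (φs : CellPath f g) :
    φs.append (nil g) = φs := by
  induction φs with
  | nil => rfl
  | cons φ hl hr φs ih => simp [append, ih]

/-- Two paths of cells whose vertical boundaries need only be propositionally equal agree. -/
structure Same {A B C D : 𝒦} {f f' : A ⟶ C} {g g' : B ⟶ D} (φs : CellPath f g)
    (φs' : CellPath f' g') : Prop where
  left : f = f'
  right : g = g'
  heq : HEq φs φs'

namespace Same

theorem refl {A B C D : 𝒦} {f : A ⟶ C} {g : B ⟶ D} (φs : CellPath f g) : Same φs φs :=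
  ⟨rfl, rfl, HEq.rfl⟩

theorem of_eq {A B C D : 𝒦} {f : A ⟶ C} {g : B ⟶ D} {φs φs' : CellPath f g} (h : φs = φs') :
    Same φs φs' :=
  h ▸ refl φs

theorem nil {A C : 𝒦} {f f' : A ⟶ C} (h : f = f') : Same (CellPath.nil f) (CellPath.nil f') := by
  subst h
  exact refl _

theorem cons {A B C D E F : 𝒦} {f f' : A ⟶ C} {g g' : B ⟶ D} {h h' : E ⟶ F} {φ φ' : Cell A B C D}
    {hl : DoubleGraph.left φ = f} {hr : DoubleGraph.right φ = g}
    {hl' : DoubleGraph.left φ' = f'} {hr' : DoubleGraph.right φ' = g'}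
    {φs : CellPath g h} {φs' : CellPath g' h'} (e : φ = φ') (es : φs.Same φs') :
    Same (CellPath.cons φ hl hr φs) (CellPath.cons φ' hl' hr' φs') := by
  obtain ⟨rfl, rfl, hh⟩ := es
  obtain rfl := eq_of_heq hh
  subst e hl hl'
  exact refl _

end Same

end Graph

end CellPath

section Ops

variable {𝒦 : Type u} [DoubleOps.{t, w, v} 𝒦]

/-- The type of a path of cells contains its vertical boundary, so plain rewriting inside `compose`
fails; this lemma replaces it throughout. -/
theorem compose_congr {A B C D E F : 𝒦} {f f' : A ⟶ C} {g g' : B ⟶ D} {φs : CellPath f g}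
    {φs' : CellPath f' g'} {ψ ψ' : Cell C D E F} (hφ : φs.Same φs') (hψ : ψ = ψ')
    (h : φs.tgt = src ψ) (h' : φs'.tgt = src ψ') : compose φs ψ h = compose φs' ψ' h' := by
  obtain ⟨rfl, rfl, hh⟩ := hφ
  obtain rfl := eq_of_heq hh
  subst hψ
  rfl

/-- The vertical composite of a path of cells with a cell, with its boundary. -/
def CellPath.comp {A B C D E F : 𝒦} {f : A ⟶ C} {g : B ⟶ D} (φs : CellPath f g) {h : C ⟶ E}
    {J : HorPath C D} {L : HorPath E F} {k : D ⟶ F} (ψ : CellOf h J L k) (hJ : φs.tgt = J) :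
    CellOf (f ≫ h) φs.src L (g ≫ k) :=
  ⟨compose φs ψ.cell (hJ.trans ψ.src_eq.symm),
    by simp [ψ.left_eq], by simp [ψ.right_eq], by simp, by simp [ψ.tgt_eq]⟩

namespace CellOf

/-- Replace the boundary of a cell by an equal one. -/
def cast {A B C D : 𝒦} {f f' : A ⟶ C} {J J' : HorPath A B} {K K' : HorPath C D} {g g' : B ⟶ D}
    (φ : CellOf f J K g) (hf : f = f') (hJ : J = J') (hK : K = K') (hg : g = g') :
    CellOf f' J' K' g' :=
  ⟨φ.cell, φ.left_eq.trans hf, φ.right_eq.trans hg, φ.src_eq.trans hJ, φ.tgt_eq.trans hK⟩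

theorem vcomp_cell_congr {A B C D E F : 𝒦} {f f' : A ⟶ C} {J J' : HorPath A B}
    {K K' : HorPath C D} {g g' : B ⟶ D} {h h' : C ⟶ E} {L L' : HorPath E F} {k k' : D ⟶ F}
    {ψ : CellOf h K L k} {ψ' : CellOf h' K' L' k'} {φ : CellOf f J K g} {φ' : CellOf f' J' K' g'}
    (hψ : ψ.cell = ψ'.cell) (hφ : φ.cell = φ'.cell) : (ψ.vcomp φ).cell = (ψ'.vcomp φ').cell :=
  compose_congr (.cons hφ (.nil (by rw [← φ.right_eq, ← φ'.right_eq, hφ]))) hψ _ _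

theorem hcomp_cell_congr {A B C M : 𝒦} {d d' : A ⟶ M} {J J' : HorPath A B} {l l' : B ⟶ M}
    {H H' : HorPath B C} {k k' : C ⟶ M} {η : CellOf d J (HPath.nil M) l}
    {ζ : CellOf l H (HPath.nil M) k} {η' : CellOf d' J' (HPath.nil M) l'}
    {ζ' : CellOf l' H' (HPath.nil M) k'} (hη : η.cell = η'.cell) (hζ : ζ.cell = ζ'.cell) :
    (η.hcomp ζ).cell = (η'.hcomp ζ').cell :=
  compose_congr (.cons hη (.cons hζ (.nil (by rw [← ζ.right_eq, ← ζ'.right_eq, hζ])))) rfl _ _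

theorem precompLast_cell_congr {A B B' C D E : 𝒦} {d d' : A ⟶ C} {p : HorPath A E} {J : Hor E B}
    {L L' : HorPath C D} {l l' : B ⟶ D} {η : CellOf d (p.snoc J) L l}
    {η' : CellOf d' (p.snoc J) L' l'} (hη : η.cell = η'.cell) {J' : Hor E B'} {f : B' ⟶ B}
    (γ : CellOf (𝟙 E) (HPath.single J') (HPath.single J) f) :
    (η.precompLast γ).cell = (η'.precompLast γ).cell :=
  compose_congr (.refl _) hη _ _

end CellOf

end Ops

variable {𝒦 : Type u} [AugmentedVirtualDoubleCategory.{t, w, v} 𝒦]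

open AugmentedVirtualDoubleCategory

/-! ### The calculus of cells -/

/-- Associativity for a grid with one column. The recorded boundaries are left free, since
composites carry them only up to a propositional equality. -/
theorem compose_single_compose {A B C D E F X Y : 𝒦} {f : A ⟶ C} {g : B ⟶ D}
    (φs : CellPath f g) (ψ : Cell C D E F) (χ : Cell E F X Y) (h : φs.tgt = src ψ)
    {a : A ⟶ E} {b : B ⟶ F} (hl : left (compose φs ψ h) = a) (hr : right (compose φs ψ h) = b)
    {a' : C ⟶ E} {b' : D ⟶ F} (hl' : left ψ = a') (hr' : right ψ = b')
    (h₁ : (CellPath.single (compose φs ψ h) hl hr).tgt = src χ)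
    (h₂ : (CellPath.single ψ hl' hr').tgt = src χ)
    (h₃ : φs.tgt = src (compose (CellPath.single ψ hl' hr') χ h₂)) :
    compose (CellPath.single (compose φs ψ h) hl hr) χ h₁ =
      compose φs (compose (CellPath.single ψ hl' hr') χ h₂) h₃ := by
  have key := compose_assoc (Grid.cons φs ψ h hl' hr' (Grid.nil g b')) χ h₂
  refine (compose_congr (.cons rfl (.nil ?_)) rfl _ _).trans
    (key.trans (compose_congr (.of_eq (CellPath.append_nil φs)) rfl _ _))
  rw [← hr, ← hr', DoubleOps.right_compose]

theorem compose_id_nil {A C D : 𝒦} (φ : Cell A A C D) (h : (CellPath.nil (𝟙 A)).tgt = src φ) :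
    compose (CellPath.nil (𝟙 A)) φ h = φ := by
  refine (compose_congr ?_ rfl _ _).trans (ids_compose φ)
  rw [← h]
  exact .refl _

namespace CellOf

variable {A B C D E F M X Y : 𝒦}

/-- Like the laws that follow, an equation of underlying cells: the boundaries of the two sides
agree only up to associativity and unit laws of vertical morphisms. -/
theorem vcomp_comp_cell {f : A ⟶ C} {g : B ⟶ D} (φs : CellPath f g) {h : C ⟶ E}
    {J : HorPath C D} {L : HorPath E F} {k : D ⟶ F} (ψ : CellOf h J L k) (hJ : φs.tgt = J)
    {a : E ⟶ X} {b : F ⟶ Y} {N : HorPath X Y} (χ : CellOf a L N b) :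
    (χ.vcomp (φs.comp ψ hJ)).cell = (φs.comp (χ.vcomp ψ) hJ).cell :=
  compose_single_compose φs ψ.cell χ.cell _ _ _ ψ.left_eq ψ.right_eq _ _ _

theorem vcomp_assoc_cell {f : A ⟶ C} {J : HorPath A B} {K : HorPath C D} {g : B ⟶ D} {h : C ⟶ E}
    {L : HorPath E F} {k : D ⟶ F} {a : E ⟶ X} {N : HorPath X Y} {b : F ⟶ Y}
    (χ : CellOf a L N b) (ψ : CellOf h K L k) (φ : CellOf f J K g) :
    (χ.vcomp (ψ.vcomp φ)).cell = ((χ.vcomp ψ).vcomp φ).cell :=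
  compose_single_compose _ ψ.cell χ.cell _ _ _ ψ.left_eq ψ.right_eq _ _ _

theorem precompLast_vcomp_cell {B' : 𝒦} {d : A ⟶ C} {p : HorPath A E} {J : Hor E B}
    {L : HorPath C D} {l : B ⟶ D} (φ : CellOf d (p.snoc J) L l) {J' : Hor E B'} {f : B' ⟶ B}
    (γ : CellOf (𝟙 E) (HPath.single J') (HPath.single J) f) {a : C ⟶ X} {b : D ⟶ Y}
    {N : HorPath X Y} (η : CellOf a L N b) :
    ((η.vcomp φ).precompLast γ).cell = (η.vcomp (φ.precompLast γ)).cell :=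
  (compose_single_compose _ φ.cell η.cell _ _ _ φ.left_eq φ.right_eq _ _ _).symm

/-- The interchange law: associativity for a grid with two columns, as `η ⊙ ζ` is the composite of
`(η, ζ)` with a vertical identity cell. -/
theorem comp_hcomp_cell {f : A ⟶ D} {g : B ⟶ E} {c : C ⟶ F} (φs : CellPath f g)
    (ζs : CellPath g c) {h : D ⟶ M} {J : HorPath D E} {l : E ⟶ M} {H : HorPath E F} {m : F ⟶ M}
    (η : CellOf h J (HPath.nil M) l) (ζ : CellOf l H (HPath.nil M) m) (hJ : φs.tgt = J)
    (hH : ζs.tgt = H) (e : (φs.append ζs).tgt = src (η.hcomp ζ).cell) :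
    compose (φs.append ζs) (η.hcomp ζ).cell e =
      ((φs.comp η hJ).hcomp (ζs.comp ζ hH)).cell := by
  have key := compose_assoc (Grid.cons φs η.cell (hJ.trans η.src_eq.symm) η.left_eq η.right_eq
    (Grid.cons ζs ζ.cell (hH.trans ζ.src_eq.symm) ζ.left_eq ζ.right_eq (Grid.nil c m)))
    (vid (𝟙 M)).cell (by simp [Grid.bot, η.tgt_eq, ζ.tgt_eq, (vid (𝟙 M)).src_eq])
  refine (compose_congr (.of_eq ?_) rfl _ _).trans key.symm
  simp [Grid.top]

theorem hcomp_vcomp_cell {J : HorPath A B} {f : A ⟶ C} {K : HorPath C D} {g : B ⟶ D}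
    (φ : CellOf f J K g) {d : C ⟶ M} {l : D ⟶ M} (η : CellOf d K (HPath.nil M) l)
    {c : X ⟶ Y} (ζs : CellPath g c) {H : HorPath D Y} {m : Y ⟶ M}
    (ζ : CellOf l H (HPath.nil M) m) (hH : ζs.tgt = H)
    (e : ((CellPath.of φ).append ζs).tgt = src (η.hcomp ζ).cell) :
    compose ((CellPath.of φ).append ζs) (η.hcomp ζ).cell e =
      ((η.vcomp φ).hcomp (ζs.comp ζ hH)).cell :=
  comp_hcomp_cell (CellPath.of φ) ζs η ζ ((CellPath.tgt_single _ _ _).trans φ.tgt_eq) hH e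

/-- Both bracketings reduce to the path `(η, ζ, ξ)` followed by two vertical identity cells and then
one more; the cell standing alone in each bracketing is first composed with a vertical identity. -/
theorem hcomp_assoc_cell {d : A ⟶ M} {J : HorPath A B} {l : B ⟶ M} {H : HorPath B C} {k : C ⟶ M}
    {L : HorPath C D} {m : D ⟶ M} (η : CellOf d J (HPath.nil M) l)
    (ζ : CellOf l H (HPath.nil M) k) (ξ : CellOf k L (HPath.nil M) m) :
    ((η.hcomp ζ).hcomp ξ).cell = (η.hcomp (ζ.hcomp ξ)).cell := by
  have hv := (vid (𝟙 M)).src_eq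
  have hw := (vid (𝟙 M)).tgt_eq
  have h₁ := compose_assoc (Grid.cons ((CellPath.of η).append (CellPath.of ζ)) (vid (𝟙 M)).cell
    (by simp [η.tgt_eq, ζ.tgt_eq, hv]) (vid (𝟙 M)).left_eq (vid (𝟙 M)).right_eq
    (Grid.cons (CellPath.of ξ) (vid (𝟙 M)).cell (by simp [ξ.tgt_eq, hv]) (vid (𝟙 M)).left_eq
      (vid (𝟙 M)).right_eq (Grid.nil m (𝟙 M)))) (vid (𝟙 M)).cell (by simp [Grid.bot, hw, hv])
  have h₂ := compose_assoc (Grid.cons (CellPath.of η) (vid (𝟙 M)).cell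
    (by simp [η.tgt_eq, hv]) (vid (𝟙 M)).left_eq (vid (𝟙 M)).right_eq
    (Grid.cons ((CellPath.of ζ).append (CellPath.of ξ)) (vid (𝟙 M)).cell
      (by simp [ζ.tgt_eq, ξ.tgt_eq, hv]) (vid (𝟙 M)).left_eq
      (vid (𝟙 M)).right_eq (Grid.nil m (𝟙 M)))) (vid (𝟙 M)).cell (by simp [Grid.bot, hw, hv])
  refine (compose_congr (.cons rfl (.cons ?_ (.nil ?_))) rfl _ _).trans
    (h₁.trans (h₂.symm.trans
      (compose_congr (.cons ?_ (.cons rfl (.nil ?_))) rfl _ _)))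
  · exact (compose_vid ξ).symm
  · exact (Category.comp_id _).symm
  · exact compose_vid η
  · exact Category.comp_id _

theorem hcomp_vid_cell {d : A ⟶ M} {J : HorPath A B} {l : B ⟶ M}
    (η : CellOf d J (HPath.nil M) l) : (η.hcomp (vid l)).cell = η.cell :=
  (insert_vid (CellPath.of η) (CellPath.nil l) (vid (𝟙 M)).cell
    (by simp [η.tgt_eq, (vid (𝟙 M)).src_eq]) _).trans
    ((compose_congr (.of_eq (CellPath.append_nil _)) rfl _ _).trans (compose_vid η))

theorem vid_hcomp_cell {d : A ⟶ M} {J : HorPath A B} {l : B ⟶ M}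
    (η : CellOf d J (HPath.nil M) l) : ((vid d).hcomp η).cell = η.cell :=
  (insert_vid (CellPath.nil d) (CellPath.of η) (vid (𝟙 M)).cell
    (by simp [CellPath.append, η.tgt_eq, (vid (𝟙 M)).src_eq]) _).trans (compose_vid η)

/-- By `insert_vid` the empty path at `f` composes as the path `(vid f)` does. -/
theorem comp_nil_vid_cell (f : A ⟶ C) (l : C ⟶ E) :
    ((CellPath.nil f).comp (vid l) rfl).cell = (vid (f ≫ l)).cell := by
  rw [← vid_compose_vid]
  exact (insert_vid (CellPath.nil f) (CellPath.nil f) (vid l).cell (vid l).src_eq.symm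
    (by simp [CellPath.append, (vid l).src_eq, (vid f).tgt_eq])).symm

theorem precompLast_hcomp_cell {B' : 𝒦} {d : A ⟶ M} {J : Hor A B} {l : B ⟶ M} {p : HorPath B E}
    {H : Hor E D} {k : D ⟶ M} (η : CellOf d (HPath.single J) (HPath.nil M) l)
    (ζ : CellOf l (p.snoc H) (HPath.nil M) k) {H' : Hor E B'} {f : B' ⟶ D}
    (γ : CellOf (𝟙 E) (HPath.single H') (HPath.single H) f) :
    (precompLast (p := HPath.cons J p) (J := H) (η.hcomp ζ) γ).cell =
      (η.hcomp (ζ.precompLast γ)).cell := by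
  refine (comp_hcomp_cell (CellPath.ids (HPath.single J)) ((CellPath.ids p).append (CellPath.of γ))
    η ζ (by simp) (by simp [γ.tgt_eq]) _).trans (hcomp_cell_congr ?_ rfl)
  have := ids_compose η.cell
  refine (compose_congr ?_ rfl _ _).trans this
  rw [η.src_eq]
  exact .refl _

end CellOf

end AVDC

end Calculus

/-! ### Cartesian cells and unique factorisation through paths -/

section Universal

open DoubleGraph (Cell left right src tgt)
open DoubleOps (hid vid compose)

namespace AVDC

variable {𝒦 : Type u} [AugmentedVirtualDoubleCategory.{t, w, v} 𝒦]

/-! ### Cartesian cells -/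

namespace IsCartesian

variable {A B C D E F : 𝒦}

theorem exists_lift {f : A ⟶ C} {J : Hor A B} {K : HorPath C D} {g : B ⟶ D}
    {ψ : CellOf f (HPath.single J) K g} (hψ : IsCartesian ψ) {X Y : 𝒦} {h : X ⟶ A} {k : Y ⟶ B}
    {H : HorPath X Y} {f' : X ⟶ C} {g' : Y ⟶ D} (χ : CellOf f' H K g') (hf : f' = h ≫ f)
    (hg : g' = k ≫ g) : ∃ χ' : CellOf h H (HPath.single J) k, (ψ.vcomp χ').cell = χ.cell := by
  obtain ⟨χ', e, -⟩ := hψ h k H (χ.cast hf rfl rfl hg)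
  exact ⟨χ', congrArg CellOf.cell e⟩

theorem hom_ext {f : A ⟶ C} {J : Hor A B} {K : HorPath C D} {g : B ⟶ D}
    {ψ : CellOf f (HPath.single J) K g} (hψ : IsCartesian ψ) {X Y : 𝒦} {h : X ⟶ A} {k : Y ⟶ B}
    {H : HorPath X Y} {χ₁ χ₂ : CellOf h H (HPath.single J) k}
    (e : (ψ.vcomp χ₁).cell = (ψ.vcomp χ₂).cell) : χ₁ = χ₂ :=
  (hψ h k H (ψ.vcomp χ₂)).unique (CellOf.ext e) rfl

theorem congr {f f' : A ⟶ C} {J : Hor A B} {K K' : HorPath C D} {g g' : B ⟶ D}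
    {ψ : CellOf f (HPath.single J) K g} {ψ' : CellOf f' (HPath.single J) K' g'}
    (hψ : IsCartesian ψ) (e : ψ.cell = ψ'.cell) : IsCartesian ψ' := by
  obtain rfl : f = f' := by rw [← ψ.left_eq, ← ψ'.left_eq, e]
  obtain rfl : g = g' := by rw [← ψ.right_eq, ← ψ'.right_eq, e]
  obtain rfl : K = K' := by rw [← ψ.tgt_eq, ← ψ'.tgt_eq, e]
  exact CellOf.ext e ▸ hψ

theorem vcomp {f : A ⟶ C} {J : Hor A B} {K : Hor C D} {g : B ⟶ D} {a : C ⟶ E} {L : HorPath E F}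
    {b : D ⟶ F} {ψ : CellOf a (HPath.single K) L b}
    {κ : CellOf f (HPath.single J) (HPath.single K) g} (hψ : IsCartesian ψ)
    (hκ : IsCartesian κ) : IsCartesian (ψ.vcomp κ) := by
  intro X Y h k H χ
  obtain ⟨χ₁, e₁⟩ := hψ.exists_lift (h := h ≫ f) (k := k ≫ g) χ (Category.assoc _ _ _).symm
    (Category.assoc _ _ _).symm
  obtain ⟨χ₂, e₂⟩ := hκ.exists_lift χ₁ rfl rfl
  refine ⟨χ₂, CellOf.ext ?_, fun χ₃ e₃ => hκ.hom_ext (congrArg CellOf.cell (hψ.hom_ext ?_))⟩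
  · rw [← CellOf.vcomp_assoc_cell, ← e₁]
    exact CellOf.vcomp_cell_congr rfl e₂
  · rw [CellOf.vcomp_assoc_cell, e₃, ← e₁]
    exact CellOf.vcomp_cell_congr rfl e₂.symm

/-- The cancellation half of the pasting lemma; it later exhibits horizontal morphisms as
restrictions of a companion. -/
theorem of_vcomp {f : A ⟶ C} {J : Hor A B} {K : Hor C D} {g : B ⟶ D} {a : C ⟶ E}
    {L : HorPath E F} {b : D ⟶ F} {ψ : CellOf a (HPath.single K) L b}
    {κ : CellOf f (HPath.single J) (HPath.single K) g} (hψ : IsCartesian ψ)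
    (hκ : IsCartesian (ψ.vcomp κ)) : IsCartesian κ := by
  intro X Y h k H χ
  obtain ⟨χ₁, e₁⟩ := hκ.exists_lift (ψ.vcomp χ) (Category.assoc _ _ _) (Category.assoc _ _ _)
  refine ⟨χ₁, hψ.hom_ext ?_, fun χ₂ e₂ => hκ.hom_ext ?_⟩
  · rw [CellOf.vcomp_assoc_cell, e₁]
  · rw [e₁, ← CellOf.vcomp_assoc_cell, e₂]

end IsCartesian

theorem isCartesian_hid {A B : 𝒦} (J : Hor A B) : IsCartesian (hid J) := by
  intro X Y h k H χ
  refine ⟨χ.cast (Category.comp_id _) rfl rfl (Category.comp_id _), CellOf.ext ?_, ?_⟩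
  · exact AugmentedVirtualDoubleCategory.compose_hid _
  · rintro χ' rfl
    exact CellOf.ext (AugmentedVirtualDoubleCategory.compose_hid χ').symm

/-! ### Unique factorisation through a path of cells -/

/-- Each cell with target `L` and vertical boundary `f ≫ h`, `g ≫ k` factors uniquely through
`φs`. -/
def FactorsThrough {A B C D E F : 𝒦} {f : A ⟶ C} {g : B ⟶ D} (φs : CellPath f g) (h : C ⟶ E)
    (L : HorPath E F) (k : D ⟶ F) : Prop :=
  ∀ χ : CellOf (f ≫ h) φs.src L (g ≫ k), ∃! χ' : CellOf h φs.tgt L k, φs.compOf χ' = χ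

namespace FactorsThrough

variable {A B C D E F : 𝒦} {f : A ⟶ C} {g : B ⟶ D} {φs : CellPath f g} {h : C ⟶ E}
  {L : HorPath E F} {k : D ⟶ F}

theorem mk {S : HorPath A B} {T : HorPath C D} (hS : φs.src = S) (hT : φs.tgt = T)
    (ex : ∀ χ : CellOf (f ≫ h) S L (g ≫ k), ∃ χ' : CellOf h T L k, (φs.comp χ' hT).cell = χ.cell)
    (inj : ∀ χ₁ χ₂ : CellOf h T L k, (φs.comp χ₁ hT).cell = (φs.comp χ₂ hT).cell → χ₁ = χ₂) :
    FactorsThrough φs h L k := by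
  subst hS hT
  intro χ
  obtain ⟨χ', e⟩ := ex χ
  refine ⟨χ', CellOf.ext e, fun χ'' e' => inj _ _ ?_⟩
  rw [e, ← e']
  rfl

theorem exists_fac (H : FactorsThrough φs h L k) {f' : A ⟶ E} {J : HorPath A B} {g' : B ⟶ F}
    (χ : CellOf f' J L g') (hf : f' = f ≫ h) (hJ : J = φs.src) (hg : g' = g ≫ k)
    {T : HorPath C D} (hT : φs.tgt = T) :
    ∃ χ' : CellOf h T L k, (φs.comp χ' hT).cell = χ.cell := by
  subst hT
  obtain ⟨χ', e, -⟩ := H (χ.cast hf hJ rfl hg)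
  exact ⟨χ', congrArg CellOf.cell e⟩

theorem hom_ext (H : FactorsThrough φs h L k) {T : HorPath C D} (hT : φs.tgt = T)
    {χ₁ χ₂ : CellOf h T L k} (e : (φs.comp χ₁ hT).cell = (φs.comp χ₂ hT).cell) : χ₁ = χ₂ := by
  subst hT
  exact (H (φs.compOf χ₂)).unique (CellOf.ext e) rfl

/-- Factorisation of the cells into a restriction `N` of `L` gives factorisation of the cells
into `L`. -/
theorem of_cartesian {E' F' : 𝒦} {N : Hor E F} {a : E ⟶ E'} {L : HorPath E' F'} {b : F ⟶ F'}
    {ψ : CellOf a (HPath.single N) L b} (hψ : IsCartesian ψ)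
    (H : FactorsThrough φs h (HPath.single N) k) : FactorsThrough φs (h ≫ a) L (k ≫ b) := by
  refine .mk rfl rfl (fun χ => ?_) fun χ₁ χ₂ e => ?_
  · obtain ⟨χ₁, e₁⟩ := hψ.exists_lift χ (Category.assoc _ _ _).symm (Category.assoc _ _ _).symm
    obtain ⟨χ₂, e₂⟩ := H.exists_fac χ₁ rfl rfl rfl rfl
    refine ⟨ψ.vcomp χ₂, ?_⟩
    rw [← CellOf.vcomp_comp_cell, ← e₁]
    exact CellOf.vcomp_cell_congr rfl e₂
  · obtain ⟨θ₁, e₁⟩ := hψ.exists_lift χ₁ rfl rfl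
    obtain ⟨θ₂, e₂⟩ := hψ.exists_lift χ₂ rfl rfl
    -- The lifts to `N` have equal composites with `φs`, because these agree after composition with
    -- `ψ`.
    obtain rfl : θ₁ = θ₂ := by
      refine H.hom_ext rfl (congrArg CellOf.cell (hψ.hom_ext ?_))
      rw [CellOf.vcomp_comp_cell, CellOf.vcomp_comp_cell]
      refine (compose_congr (.refl _) e₁ _ _).trans (e.trans (compose_congr (.refl _) e₂.symm _ _))
    exact CellOf.ext (e₁.symm.trans e₂)

/-- Factorisation of the cells into `L` gives factorisation of the cells into a restriction `N`
of `L`. -/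
theorem to_cartesian {E' F' : 𝒦} {N : Hor E F} {a : E ⟶ E'} {L : HorPath E' F'} {b : F ⟶ F'}
    {ψ : CellOf a (HPath.single N) L b} (hψ : IsCartesian ψ)
    (H : FactorsThrough φs (h ≫ a) L (k ≫ b)) : FactorsThrough φs h (HPath.single N) k := by
  refine .mk rfl rfl (fun χ => ?_) fun χ₁ χ₂ e => ?_
  · obtain ⟨χ₁, e₁⟩ := H.exists_fac (ψ.vcomp χ) (Category.assoc _ _ _) rfl
      (Category.assoc _ _ _) rfl
    obtain ⟨χ₂, e₂⟩ := hψ.exists_lift χ₁ rfl rfl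
    refine ⟨χ₂, congrArg CellOf.cell (hψ.hom_ext ?_)⟩
    rw [CellOf.vcomp_comp_cell, ← e₁]
    exact compose_congr (.refl _) e₂ _ _
  · refine hψ.hom_ext (congrArg CellOf.cell (H.hom_ext rfl ?_))
    rw [← CellOf.vcomp_comp_cell, ← CellOf.vcomp_comp_cell]
    exact CellOf.vcomp_cell_congr rfl e

end FactorsThrough

theorem isWeaklyCocartesian_iff {n : ℕ} {A B C D : 𝒦} {f : A ⟶ C} {g : B ⟶ D}
    {φs : CellPath f g} :
    IsWeaklyCocartesian n φs ↔ ∀ {E F : 𝒦} (h : C ⟶ E) (k : D ⟶ F) (L : HorPath E F),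
      L.length = n → FactorsThrough φs h L k := Iff.rfl

theorem HPath.exists_eq_single {O : Type u} {Hor : O → O → Type w} {A B : O} (L : HPath Hor A B)
    (h : L.length = 1) : ∃ N : Hor A B, L = HPath.single N := by
  cases L with
  | nil => simp [HPath.length] at h
  | cons N p =>
    cases p with
    | nil => exact ⟨N, rfl⟩
    | cons => simp [HPath.length] at h

/-- Nullary cells into `E` correspond to unary cells into the horizontal unit of `E`. -/
theorem IsWeaklyCocartesian.nullary_of_isUnital (hU : IsUnital 𝒦) {A B C D : 𝒦} {f : A ⟶ C}
    {g : B ⟶ D} {φs : CellPath f g} (hφ : IsWeaklyCocartesian 1 φs) : IsWeaklyCocartesian 0 φs := by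
  rw [isWeaklyCocartesian_iff]
  intro E F h k L hL
  cases L with
  | cons => simp [HPath.length] at hL
  | nil =>
    obtain ⟨I, ψ, hψ⟩ := hU E
    simpa using FactorsThrough.of_cartesian hψ (hφ h k (HPath.single I) rfl)

theorem IsRightCocartesianFor.nullary_of_isUnital (hU : IsUnital 𝒦) {s : Strength} {A B C D : 𝒦}
    {f : A ⟶ C} {g : B ⟶ D} {φs : CellPath f g} (hφ : IsRightCocartesianFor 1 s φs) :
    IsRightCocartesianFor 0 s φs := by
  cases s with
  | full => exact fun ζs hζ => IsWeaklyCocartesian.nullary_of_isUnital hU (hφ ζs hζ)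
  | weak => exact IsWeaklyCocartesian.nullary_of_isUnital hU hφ

/-! ### Extensions of a given strength -/

/-- The paths of horizontal morphisms along which a (weakly) left Kan cell is tested. -/
inductive Strength.Allows : Strength → {B C : 𝒦} → HorPath B C → Prop
  | nil (s : Strength) (B : 𝒦) : Allows s (HPath.nil B)
  | full {B C : 𝒦} (H : HorPath B C) : Allows .full H

/-- The paths of cells by which a right (respectively weakly) cocartesian path is extended. -/
inductive Strength.AllowsExtension : Strength → {B D : 𝒦} → {g : B ⟶ D} → {Y Z : 𝒦} →
    {k : Y ⟶ Z} → CellPath g k → Prop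
  | nil (s : Strength) {B D : 𝒦} (g : B ⟶ D) : AllowsExtension s (CellPath.nil g)
  | full {B D : 𝒦} {g : B ⟶ D} {Y Z : 𝒦} {k : Y ⟶ Z} {ζs : CellPath g k}
      (h : IsRightExtension g ζs) : AllowsExtension .full ζs

/-- With this and the analogous statement for cocartesian paths, the full and weak versions are
proved by one argument that differs only in the admissible test paths. -/
theorem isLeftKan_iff {s : Strength} {A B M : 𝒦} {d : A ⟶ M} {J : HorPath A B} {l : B ⟶ M}
    {η : CellOf d J (HPath.nil M) l} :
    IsLeftKan s η ↔ ∀ {C : 𝒦} (H : HorPath B C), s.Allows H → FactorsUniquely η H := by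
  cases s with
  | full => exact ⟨fun h _ H _ => h H, fun h _ H => h H (.full H)⟩
  | weak => exact ⟨fun h _ H hH => by cases hH; exact h, fun h => h _ (.nil _ _)⟩

theorem isRightCocartesianFor_iff {n : ℕ} {s : Strength} {A B C D : 𝒦} {f : A ⟶ C} {g : B ⟶ D}
    {φs : CellPath f g} :
    IsRightCocartesianFor n s φs ↔ ∀ {Y Z : 𝒦} {k : Y ⟶ Z} (ζs : CellPath g k),
      s.AllowsExtension ζs → IsWeaklyCocartesian n (φs.append ζs) := by
  cases s with
  | full =>
    refine ⟨fun h _ _ _ ζs hζ => ?_, fun h _ _ _ ζs hζ => h ζs (.full hζ)⟩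
    cases hζ with
    | nil => exact h _ .nil
    | full hζ => exact h _ hζ
  | weak =>
    refine ⟨fun h _ _ _ ζs hζ => ?_, fun h => ?_⟩
    · cases hζ
      rw [CellPath.append_nil]
      exact h
    · have : IsWeaklyCocartesian n (φs.append (.nil g)) := h _ (.nil _ _)
      rwa [CellPath.append_nil] at this

namespace Strength

variable {s : Strength}

/-- The first identity cell of a nonempty path is cartesian, hence defines a restriction `K(id,
id)`. -/
theorem Allows.extension_ids {B C : 𝒦} {H : HorPath B C} (hH : s.Allows H) :
    s.AllowsExtension (CellPath.ids H) := by
  cases hH with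
  | nil => exact .nil _ _
  | full =>
    cases H with
    | nil => exact .nil _ _
    | cons K Ks => exact .full (.cart K Ks K (hid K) (isCartesian_hid K))

theorem AllowsExtension.src {B D Y Z : 𝒦} {g : B ⟶ D} {k : Y ⟶ Z} {ζs : CellPath g k}
    (h : s.AllowsExtension ζs) : s.Allows ζs.src := by
  cases h with
  | nil => exact .nil _ _
  | full => exact .full _

theorem AllowsExtension.tgt {B D Y Z : 𝒦} {g : B ⟶ D} {k : Y ⟶ Z} {ζs : CellPath g k}
    (h : s.AllowsExtension ζs) : s.Allows ζs.tgt := by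
  cases h with
  | nil => exact .nil _ _
  | full => exact .full _

end Strength

/-- The grid of horizontal identity cells on horizontal identity cells. -/
def Grid.ids {A B : 𝒦} : HorPath A B → Grid (𝟙 A) (𝟙 A) (𝟙 B) (𝟙 B)
  | .nil _ => Grid.nil (𝟙 _) (𝟙 _)
  | .cons J p => Grid.cons (CellPath.of (hid J)) (hid J).cell
      ((CellPath.tgt_single _ _ _).trans ((hid J).tgt_eq.trans (hid J).src_eq.symm))
      (hid J).left_eq (hid J).right_eq (Grid.ids p)

theorem Grid.top_ids {A B : 𝒦} (p : HorPath A B) : (Grid.ids p).top = CellPath.ids p := by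
  induction p with
  | nil => rfl
  | cons J p ih => simp [Grid.ids, Grid.top, CellPath.ids, ih, CellPath.single, CellPath.append]

theorem Grid.bot_ids {A B : 𝒦} (p : HorPath A B) : (Grid.ids p).bot = CellPath.ids p := by
  induction p with
  | nil => rfl
  | cons J p ih => simp [Grid.ids, Grid.bot, CellPath.ids, ih]

theorem Grid.composites_ids {A B : 𝒦} (p : HorPath A B) :
    (Grid.ids p).composites.Same (CellPath.ids p) := by
  induction p with
  | nil => exact .nil (Category.comp_id _)
  | cons J p ih => exact .cons (AugmentedVirtualDoubleCategory.compose_hid (hid J)) ih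

/-- Associativity for a grid whose columns after the first consist of identity cells; it serves to
invert paths `(cart, id, …, id)`. -/
theorem compose_cons_ids {A B X C D : 𝒦} {f : A ⟶ B} {h : B ⟶ D} {J : HorPath A X}
    {K : HorPath B X} {L : HorPath D X} (δ : CellOf f J K (𝟙 X)) (γ : CellOf h K L (𝟙 X))
    (Ks : HorPath X C) {F Y : 𝒦} (χ : Cell D C F Y)
    (hχ : (CellPath.cons γ.cell γ.left_eq γ.right_eq (CellPath.ids Ks)).tgt = src χ)
    (hχ' : (CellPath.cons δ.cell δ.left_eq δ.right_eq (CellPath.ids Ks)).tgt =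
      src (compose (CellPath.cons γ.cell γ.left_eq γ.right_eq (CellPath.ids Ks)) χ hχ))
    (hχ'' : (CellPath.cons (γ.vcomp δ).cell rfl (by simp [(γ.vcomp δ).right_eq])
      (CellPath.ids Ks)).tgt = src χ) :
    compose (CellPath.cons δ.cell δ.left_eq δ.right_eq (CellPath.ids Ks))
      (compose (CellPath.cons γ.cell γ.left_eq γ.right_eq (CellPath.ids Ks)) χ hχ) hχ' =
      compose (CellPath.cons (γ.vcomp δ).cell rfl (by simp [(γ.vcomp δ).right_eq])
        (CellPath.ids Ks)) χ hχ'' := by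
  have key := AugmentedVirtualDoubleCategory.compose_assoc
    (Grid.cons (CellPath.of δ) γ.cell
      ((CellPath.tgt_single _ _ _).trans (δ.tgt_eq.trans γ.src_eq.symm)) γ.left_eq γ.right_eq
      (Grid.ids Ks)) χ (by simpa [Grid.bot, Grid.bot_ids] using hχ)
  refine Eq.trans ?_ (key.symm.trans (compose_congr (.cons rfl (Grid.composites_ids Ks)) rfl _ _))
  refine compose_congr (.of_eq ?_) (compose_congr (.of_eq ?_) rfl _ _) _ _
  · simp [Grid.top, Grid.top_ids, CellPath.single, CellPath.append]
  · simp [Grid.bot, Grid.bot_ids]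

end AVDC

end Universal

/-! ### Left Kan cells, and their relation to factorisation through a cell -/

section Kan

open DoubleGraph (Cell left right src tgt)
open DoubleOps (hid vid compose)

namespace AVDC

variable {𝒦 : Type u} [AugmentedVirtualDoubleCategory.{t, w, v} 𝒦]

theorem factorsThrough_nil {A E F : 𝒦} (h : A ⟶ E) (L : HorPath E F) (k : A ⟶ F) :
    FactorsThrough (CellPath.nil (𝟙 A)) h L k := by
  refine .mk rfl rfl (fun χ => ?_) fun χ₁ χ₂ e => CellOf.ext ?_
  · exact ⟨χ.cast (Category.id_comp _) rfl rfl (Category.id_comp _), compose_id_nil _ _⟩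
  · exact (compose_id_nil χ₁.cell _).symm.trans (e.trans (compose_id_nil χ₂.cell _))

theorem ids_comp_cell {A B C D : 𝒦} {f : A ⟶ C} {J : HorPath A B} {K : HorPath C D} {g : B ⟶ D}
    (φ : CellOf f J K g) : ((CellPath.ids J).comp φ (CellPath.tgt_ids J)).cell = φ.cell := by
  refine (compose_congr ?_ rfl _ _).trans (AugmentedVirtualDoubleCategory.ids_compose φ.cell)
  rw [φ.src_eq]
  exact .refl _

/-- A cartesian cell with identities as vertical boundary is invertible. -/
theorem IsCartesian.exists_inverse {A B : 𝒦} {J K : Hor A B}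
    {γ : CellOf (𝟙 A) (HPath.single J) (HPath.single K) (𝟙 B)} (hγ : IsCartesian γ) :
    ∃ δ : CellOf (𝟙 A) (HPath.single K) (HPath.single J) (𝟙 B),
      (γ.vcomp δ).cell = (hid K).cell ∧ (δ.vcomp γ).cell = (hid J).cell := by
  obtain ⟨δ, e⟩ := hγ.exists_lift (h := 𝟙 A) (k := 𝟙 B) (hid K) (Category.comp_id _).symm
    (Category.comp_id _).symm
  refine ⟨δ, e, ?_⟩
  -- Cancel `γ` in `γ ∘ δ ∘ γ = γ = γ ∘ id`.
  have h := hγ.hom_ext (χ₁ := δ.vcomp γ)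
    (χ₂ := (hid J).cast (Category.comp_id _).symm rfl rfl (Category.comp_id _).symm) ?_
  · exact congrArg CellOf.cell h
  · exact (CellOf.vcomp_assoc_cell γ δ γ).trans ((CellOf.vcomp_cell_congr e rfl).trans
      ((AugmentedVirtualDoubleCategory.compose_hid γ).trans ((ids_comp_cell γ).symm.trans
        (CellOf.vcomp_cell_congr (φ := hid J) rfl rfl))))

/-- An extension of a path with vertical target `𝟙 D` uses a restriction `K(id, id)`. Its cartesian
cell is invertible, so the whole extending path is. -/
theorem Strength.AllowsExtension.factorsThrough {s : Strength} {D Y Z : 𝒦} {k : Y ⟶ Z}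
    {ζs : CellPath (𝟙 D) k} (hζ : s.AllowsExtension ζs) {E F : 𝒦} (h : D ⟶ E) (L : HorPath E F)
    (l : Z ⟶ F) : FactorsThrough ζs h L l := by
  cases hζ with
  | nil => exact factorsThrough_nil h L l
  | full hζ =>
    cases hζ with
    | nil => exact factorsThrough_nil h L l
    | cart K Ks K' γ hγ =>
      obtain ⟨δ, e₁, e₂⟩ := hγ.exists_inverse
      have hsγ : (CellPath.cons γ.cell γ.left_eq γ.right_eq (CellPath.ids Ks)).src =
        HPath.cons K' Ks := by simp [γ.src_eq]
      have htγ : (CellPath.cons γ.cell γ.left_eq γ.right_eq (CellPath.ids Ks)).tgt =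
        HPath.cons K Ks := by simp [γ.tgt_eq]
      have hsδ : (CellPath.cons δ.cell δ.left_eq δ.right_eq (CellPath.ids Ks)).src =
        HPath.cons K Ks := by simp [δ.src_eq]
      have htδ : (CellPath.cons δ.cell δ.left_eq δ.right_eq (CellPath.ids Ks)).tgt =
        HPath.cons K' Ks := by simp [δ.tgt_eq]
      refine .mk hsγ htγ (fun χ => ?_) fun χ₁ χ₂ e => CellOf.ext ?_
      · refine ⟨(CellPath.comp _ χ htδ).cast (by simp) hsδ rfl (by simp), ?_⟩
        refine (compose_cons_ids γ δ Ks χ.cell (htδ.trans χ.src_eq.symm) _ ?_).trans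
          ((compose_congr (.cons e₂ (.refl _)) rfl _ ?_).trans (ids_comp_cell χ))
        · simp [(δ.vcomp γ).tgt_eq]
        · exact (CellPath.tgt_ids (HPath.cons K' Ks)).trans χ.src_eq.symm
      -- The path `(δ, id, …, id)` undoes composition with `(γ, id, …, id)`.
      · have key : ∀ χ : CellOf h (HPath.cons K Ks) L l,
            compose (CellPath.cons δ.cell δ.left_eq δ.right_eq (CellPath.ids Ks))
              (CellPath.comp _ χ htγ).cell
              (htδ.trans (hsγ.symm.trans (CellOf.src_eq _).symm)) = χ.cell := fun χ => by
          refine (compose_cons_ids δ γ Ks χ.cell (htγ.trans χ.src_eq.symm) _ ?_).trans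
            ((compose_congr (.cons e₁ (.refl _)) rfl _ ?_).trans (ids_comp_cell χ))
          · simp [(γ.vcomp δ).tgt_eq]
          · exact (CellPath.tgt_ids (HPath.cons K Ks)).trans χ.src_eq.symm
        exact (key χ₁).symm.trans ((compose_congr (.refl _) e _ _).trans (key χ₂))

/-! ### Left Kan extension -/

namespace FactorsUniquely

variable {A B C M : 𝒦} {d : A ⟶ M} {J : HorPath A B} {l : B ⟶ M}
  {η : CellOf d J (HPath.nil M) l} {H : HorPath B C}

theorem mk {J' : HorPath A C} (hJ : J' = J.append H)
    (ex : ∀ (k : C ⟶ M) (φ : CellOf d J' (HPath.nil M) k),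
      ∃ φ' : CellOf l H (HPath.nil M) k, (η.hcomp φ').cell = φ.cell)
    (inj : ∀ (k : C ⟶ M) (φ₁ φ₂ : CellOf l H (HPath.nil M) k),
      (η.hcomp φ₁).cell = (η.hcomp φ₂).cell → φ₁ = φ₂) : FactorsUniquely η H := by
  subst hJ
  intro k φ
  obtain ⟨φ', e⟩ := ex k φ
  refine ⟨φ', CellOf.ext e, fun φ'' e' => inj _ _ _ ?_⟩
  rw [e, ← e']

theorem exists_fac (h : FactorsUniquely η H) {d' : A ⟶ M} {J' : HorPath A C} {k : C ⟶ M}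
    (φ : CellOf d' J' (HPath.nil M) k) (hd : d' = d) (hJ : J' = J.append H) :
    ∃ φ' : CellOf l H (HPath.nil M) k, (η.hcomp φ').cell = φ.cell := by
  obtain ⟨φ', e, -⟩ := h k (φ.cast hd hJ rfl rfl)
  exact ⟨φ', congrArg CellOf.cell e⟩

theorem hom_ext (h : FactorsUniquely η H) {k : C ⟶ M} {φ₁ φ₂ : CellOf l H (HPath.nil M) k}
    (e : (η.hcomp φ₁).cell = (η.hcomp φ₂).cell) : φ₁ = φ₂ :=
  (h k (η.hcomp φ₂)).unique (CellOf.ext e) rfl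

end FactorsUniquely

namespace IsLeftKan

variable {s : Strength} {A B D E M : 𝒦}

theorem factorsUniquely {d : A ⟶ M} {J : HorPath A B} {l : B ⟶ M}
    {η : CellOf d J (HPath.nil M) l} (h : IsLeftKan s η) {C : 𝒦} {H : HorPath B C}
    (hH : s.Allows H) : FactorsUniquely η H :=
  isLeftKan_iff.1 h H hH

theorem of_full {d : A ⟶ M} {J : HorPath A B} {l : B ⟶ M} {η : CellOf d J (HPath.nil M) l}
    (h : IsLeftKan .full η) : IsLeftKan s η :=
  isLeftKan_iff.2 fun H _ => h H

theorem toWeak {d : A ⟶ M} {J : HorPath A B} {l : B ⟶ M} {η : CellOf d J (HPath.nil M) l}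
    (h : IsLeftKan s η) : IsLeftKan .weak η :=
  h.factorsUniquely (.nil s B)

theorem congr {d d' : A ⟶ M} {J J' : HorPath A B} {l l' : B ⟶ M}
    {η : CellOf d J (HPath.nil M) l} {η' : CellOf d' J' (HPath.nil M) l'} (h : IsLeftKan s η)
    (e : η.cell = η'.cell) : IsLeftKan s η' := by
  obtain rfl : d = d' := by rw [← η.left_eq, ← η'.left_eq, e]
  obtain rfl : l = l' := by rw [← η.right_eq, ← η'.right_eq, e]
  obtain rfl : J = J' := by rw [← η.src_eq, ← η'.src_eq, e]
  exact CellOf.ext e ▸ h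

/-- The pasting lemma for left Kan cells. -/
theorem hcomp_iff {d : A ⟶ M} {J : HorPath A B} {l : B ⟶ M} {η : CellOf d J (HPath.nil M) l}
    (hη : IsLeftKan .full η) {H : HorPath B D} {k : D ⟶ M} {ζ : CellOf l H (HPath.nil M) k} :
    IsLeftKan s (η.hcomp ζ) ↔ IsLeftKan s ζ := by
  refine ⟨fun h => isLeftKan_iff.2 fun {C} L hL => ?_, fun h => isLeftKan_iff.2 fun {C} L hL => ?_⟩
  · refine .mk rfl (fun m φ => ?_) fun m φ₁ φ₂ e => ?_
    · obtain ⟨φ', e⟩ := (h.factorsUniquely hL).exists_fac (η.hcomp φ) rfl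
        (HPath.append_assoc _ _ _).symm
      -- Since `φ'` factors `η ⊙ φ` through `η ⊙ ζ`, cancelling `η` leaves `ζ ⊙ φ' = φ`.
      refine ⟨φ', congrArg CellOf.cell ((hη (H.append L)).hom_ext ?_)⟩
      rw [← CellOf.hcomp_assoc_cell, e]
    · refine (h.factorsUniquely hL).hom_ext ?_
      rw [CellOf.hcomp_assoc_cell, CellOf.hcomp_assoc_cell]
      exact CellOf.hcomp_cell_congr rfl e
  · refine .mk (HPath.append_assoc _ _ _).symm (fun m φ => ?_) fun m φ₁ φ₂ e => ?_
    -- Here `η` is tested on `H ⌢ L`, which may be nonempty even when `L` is empty; so `η` is taken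
    -- fully left Kan in the weak version too.
    · obtain ⟨φ₁, e₁⟩ := (hη (H.append L)).exists_fac φ rfl rfl
      obtain ⟨φ₂, e₂⟩ := (h.factorsUniquely hL).exists_fac φ₁ rfl rfl
      refine ⟨φ₂, ?_⟩
      rw [CellOf.hcomp_assoc_cell, ← e₁]
      exact CellOf.hcomp_cell_congr rfl e₂
    · rw [CellOf.hcomp_assoc_cell, CellOf.hcomp_assoc_cell] at e
      exact (h.factorsUniquely hL).hom_ext (congrArg CellOf.cell ((hη (H.append L)).hom_ext e))

/-- Left Kan cells are stable under horizontal composition with invertible vertical cells. -/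
theorem hcomp_inverse {d : A ⟶ M} {J : HorPath A B} {l l' : B ⟶ M}
    {η : CellOf d J (HPath.nil M) l} (hη : IsLeftKan s η)
    {α : CellOf l (HPath.nil B) (HPath.nil M) l'} {β : CellOf l' (HPath.nil B) (HPath.nil M) l}
    (h₁ : (α.hcomp β).cell = (vid l).cell) (h₂ : (β.hcomp α).cell = (vid l').cell) :
    IsLeftKan s (η.hcomp α) := by
  have cancel : ∀ {C : 𝒦} {a b : B ⟶ M} {L : HorPath B C} {k : C ⟶ M}
      (α : CellOf a (HPath.nil B) (HPath.nil M) b) (β : CellOf b (HPath.nil B) (HPath.nil M) a)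
      (_ : (α.hcomp β).cell = (vid a).cell) (ζ : CellOf a L (HPath.nil M) k),
      (α.hcomp (β.hcomp ζ)).cell = ζ.cell := by
    intro C a b L k α β h ζ
    rw [← CellOf.hcomp_assoc_cell, CellOf.hcomp_cell_congr (η' := vid a) (ζ' := ζ) h rfl,
      CellOf.vid_hcomp_cell]
  refine isLeftKan_iff.2 fun {C} L hL => .mk (J' := J.append L) (by simp) (fun m φ => ?_)
    fun m φ₁ φ₂ e => CellOf.ext ?_
  · obtain ⟨φ', e⟩ := (hη.factorsUniquely hL).exists_fac φ rfl rfl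
    refine ⟨β.hcomp φ', ?_⟩
    exact (CellOf.hcomp_assoc_cell η α (β.hcomp φ')).trans
      ((CellOf.hcomp_cell_congr rfl (cancel α β h₁ φ')).trans e)
  · rw [CellOf.hcomp_assoc_cell, CellOf.hcomp_assoc_cell] at e
    have e' : α.hcomp φ₁ = α.hcomp φ₂ := (hη.factorsUniquely hL).hom_ext e
    rw [← cancel β α h₂ φ₁, ← cancel β α h₂ φ₂]
    exact CellOf.hcomp_cell_congr rfl (congrArg CellOf.cell e')

/-- Two weakly left Kan cells along the same path differ by an invertible vertical cell. -/
theorem exists_inverse {d : A ⟶ M} {J : HorPath A B} {l l' : B ⟶ M}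
    {η : CellOf d J (HPath.nil M) l} {η' : CellOf d J (HPath.nil M) l'}
    (hη : IsLeftKan .weak η) (hη' : IsLeftKan .weak η') :
    ∃ (α : CellOf l (HPath.nil B) (HPath.nil M) l') (β : CellOf l' (HPath.nil B) (HPath.nil M) l),
      (η.hcomp α).cell = η'.cell ∧ (α.hcomp β).cell = (vid l).cell ∧
        (β.hcomp α).cell = (vid l').cell := by
  obtain ⟨α, e₁⟩ := FactorsUniquely.exists_fac hη η' rfl (by simp)
  obtain ⟨β, e₂⟩ := FactorsUniquely.exists_fac hη' η rfl (by simp)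
  refine ⟨α, β, e₁, congrArg CellOf.cell (FactorsUniquely.hom_ext hη ?_),
    congrArg CellOf.cell (FactorsUniquely.hom_ext hη' ?_)⟩
  · exact (CellOf.hcomp_assoc_cell η α β).symm.trans ((CellOf.hcomp_cell_congr e₁ rfl).trans
      (e₂.trans (CellOf.hcomp_vid_cell η).symm))
  · exact (CellOf.hcomp_assoc_cell η' β α).symm.trans ((CellOf.hcomp_cell_congr e₂ rfl).trans
      (e₁.trans (CellOf.hcomp_vid_cell η').symm))

/-- Whether `η ∘ φ` is left Kan does not depend on the weakly left Kan cell `η`. -/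
theorem vcomp_congr {C : 𝒦} {f : C ⟶ A} {J' : HorPath C D} {g : D ⟶ B} {d : A ⟶ M}
    {J : HorPath A B} {l l' : B ⟶ M} {η : CellOf d J (HPath.nil M) l}
    {η' : CellOf d J (HPath.nil M) l'} (hη : IsLeftKan .weak η) (hη' : IsLeftKan .weak η')
    {φ : CellOf f J' J g} (h : IsLeftKan s (η.vcomp φ)) : IsLeftKan s (η'.vcomp φ) := by
  obtain ⟨α, β, e, h₁, h₂⟩ := hη.exists_inverse hη'
  -- Precomposition with `g` keeps `α` and `β` mutually inverse, and by interchange `(η ∘ φ) ⊙ (α ∘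
  -- g) = (η ⊙ α) ∘ φ = η' ∘ φ`.
  have whisker : ∀ {a b : B ⟶ M} (α : CellOf a (HPath.nil B) (HPath.nil M) b)
      (β : CellOf b (HPath.nil B) (HPath.nil M) a), (α.hcomp β).cell = (vid a).cell →
      (((CellPath.nil g).comp α rfl).hcomp ((CellPath.nil g).comp β rfl)).cell =
        (vid (g ≫ a)).cell := by
    intro a b α β h
    rw [← CellOf.comp_nil_vid_cell, ← CellOf.comp_hcomp_cell _ _ α β rfl rfl
      (CellOf.src_eq _).symm]
    exact compose_congr (.refl _) h _ _
  refine (h.hcomp_inverse (whisker α β h₁) (whisker β α h₂)).congr ?_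
  exact (CellOf.hcomp_vcomp_cell φ η (CellPath.nil g) α rfl
    (by simp [φ.tgt_eq, (η.hcomp α).src_eq])).symm.trans
      (compose_congr (.of_eq (CellPath.append_nil _)) e _ _)

end IsLeftKan

/-! ### Exactness and cocartesianness -/

variable {s : Strength} {A C D E M : 𝒦}

/-- A cell out of `J ⌢ H` factors first through `(φ, id, …, id)` and then through `η`; interchange
combines the two into a factorisation through `η ∘ φ`. -/
theorem IsLeftKan.vcomp_of_factorsThrough {f : A ⟶ C} {J : HorPath A D} {K : HorPath C D}
    {φ : CellOf f J K (𝟙 D)} {d : C ⟶ M} {l : D ⟶ M} {η : CellOf d K (HPath.nil M) l}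
    (hη : IsLeftKan s η)
    (h : ∀ {X : 𝒦} (H : HorPath D X), s.Allows H → ∀ k : X ⟶ M,
      FactorsThrough ((CellPath.of φ).append (CellPath.ids H)) d (HPath.nil M) k) :
    IsLeftKan s (η.vcomp φ) := by
  refine isLeftKan_iff.2 fun {X} H hH => ?_
  have hS : ((CellPath.of φ).append (CellPath.ids H)).src = J.append H := by simp [φ.src_eq]
  have hT : ((CellPath.of φ).append (CellPath.ids H)).tgt = K.append H := by simp [φ.tgt_eq]
  -- `ζ` and `ζ'` are one cell, with vertical source read as `𝟙 D ≫ l` and as `l`.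
  have key : ∀ {k : X ⟶ M} (ζ : CellOf (𝟙 D ≫ l) H (HPath.nil M) k) (ζ' : CellOf l H (HPath.nil M) k),
      ζ.cell = ζ'.cell →
      (((CellPath.of φ).append (CellPath.ids H)).comp (η.hcomp ζ') hT).cell =
        ((η.vcomp φ).hcomp ζ).cell := fun ζ ζ' e =>
    (CellOf.hcomp_vcomp_cell φ η (CellPath.ids H) ζ' (CellPath.tgt_ids H)
      (hT.trans (CellOf.src_eq _).symm)).trans
      (CellOf.hcomp_cell_congr rfl ((ids_comp_cell ζ').trans e.symm))
  refine .mk rfl (fun k χ => ?_) fun k ζ₁ ζ₂ e => CellOf.ext ?_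
  · obtain ⟨χ', e'⟩ := (h H hH k).exists_fac χ rfl hS.symm (Category.id_comp k).symm hT
    obtain ⟨ζ, e⟩ := (hη.factorsUniquely hH).exists_fac χ' rfl rfl
    refine ⟨ζ.cast (Category.id_comp l).symm rfl rfl rfl, ?_⟩
    rw [← key _ ζ rfl, ← e']
    exact compose_congr (.refl _) e _ _
  · rw [← key ζ₁ (ζ₁.cast (Category.id_comp l) rfl rfl rfl) rfl,
      ← key ζ₂ (ζ₂.cast (Category.id_comp l) rfl rfl rfl) rfl] at e
    exact (congrArg CellOf.cell ((hη.factorsUniquely hH).hom_ext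
      (congrArg CellOf.cell ((h H hH k).hom_ext hT e))) :)

/-- Two-out-of-three: factorisation through `η ∘ φ` and through `η` forces it through `φ`. The
extension `ζs` is harmless because cells factor uniquely through it. -/
theorem IsLeftKan.factorsThrough_of_vcomp {f : A ⟶ C} {J : HorPath A D} {K : HorPath C D}
    {φ : CellOf f J K (𝟙 D)} {d : C ⟶ M} {l : D ⟶ M} {η : CellOf d K (HPath.nil M) l}
    (hη : IsLeftKan s η) (h : IsLeftKan s (η.vcomp φ)) {Y Z : 𝒦} {b : Y ⟶ Z}
    {ζs : CellPath (𝟙 D) b} (hζ : s.AllowsExtension ζs) (k : Z ⟶ M) :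
    FactorsThrough ((CellPath.of φ).append ζs) d (HPath.nil M) k := by
  have hS : ((CellPath.of φ).append ζs).src = J.append ζs.src := by simp [φ.src_eq]
  have hT : ((CellPath.of φ).append ζs).tgt = K.append ζs.tgt := by simp [φ.tgt_eq]
  have key : ∀ ζ : CellOf l ζs.tgt (HPath.nil M) k,
      (((CellPath.of φ).append ζs).comp (η.hcomp ζ) hT).cell =
        ((η.vcomp φ).hcomp (ζs.comp ζ rfl)).cell := fun ζ =>
    CellOf.hcomp_vcomp_cell φ η ζs ζ rfl (hT.trans (CellOf.src_eq _).symm)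
  refine .mk hS hT (fun χ => ?_) fun χ₁ χ₂ e => CellOf.ext ?_
  · obtain ⟨ζ, e⟩ := (h.factorsUniquely hζ.src).exists_fac χ rfl rfl
    obtain ⟨ζ', e'⟩ := (hζ.factorsThrough l (HPath.nil M) k).exists_fac ζ rfl rfl rfl rfl
    refine ⟨η.hcomp ζ', ?_⟩
    rw [key, ← e]
    exact CellOf.hcomp_cell_congr rfl e'
  -- For uniqueness both candidates are written as `η ⊙ ζᵢ`; then `η ∘ φ` and `ζs` are cancelled in
  -- turn.
  · obtain ⟨ζ₁, e₁⟩ := (hη.factorsUniquely hζ.tgt).exists_fac χ₁ rfl rfl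
    obtain ⟨ζ₂, e₂⟩ := (hη.factorsUniquely hζ.tgt).exists_fac χ₂ rfl rfl
    have e' : ((η.vcomp φ).hcomp (ζs.comp ζ₁ rfl)).cell =
        ((η.vcomp φ).hcomp (ζs.comp ζ₂ rfl)).cell := by
      rw [← key, ← key]
      exact (compose_congr (.refl _) e₁ _ _).trans
        (e.trans (compose_congr (.refl _) e₂.symm _ _))
    have e₃ := (h.factorsUniquely hζ.src).hom_ext e'
    rw [← e₁, ← e₂, (hζ.factorsThrough l (HPath.nil M) k).hom_ext rfl (congrArg CellOf.cell e₃)]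

end AVDC

end Kan

/-! ### Pointwise notions, Yoneda morphisms, and the single implications -/

section Pointwise

open DoubleGraph (Cell left right src tgt)
open DoubleOps (hid vid compose)

namespace AVDC

variable {𝒦 : Type u} [AugmentedVirtualDoubleCategory.{t, w, v} 𝒦] {s : Strength}

namespace IsPointwiseLeftKan

variable {A B C D E M : 𝒦}

theorem congr {d d' : A ⟶ M} {p : HorPath A E} {J : Hor E B} {l l' : B ⟶ M}
    {η : CellOf d (p.snoc J) (HPath.nil M) l} {η' : CellOf d' (p.snoc J) (HPath.nil M) l'}
    (h : IsPointwiseLeftKan s p J η) (e : η.cell = η'.cell) : IsPointwiseLeftKan s p J η' :=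
  ⟨h.1.congr e, fun f J' γ hγ => (h.2 f J' γ hγ).congr (CellOf.precompLast_cell_congr e γ)⟩

/-- Restricting the last horizontal morphism changes `ζ` only, so the pasting lemma applies to each
restriction. -/
theorem hcomp_iff {d : A ⟶ M} {J : Hor A B} {l : B ⟶ M}
    {η : CellOf d (HPath.single J) (HPath.nil M) l} (hη : IsLeftKan .full η) {p : HorPath B E}
    {H : Hor E D} {k : D ⟶ M} {ζ : CellOf l (p.snoc H) (HPath.nil M) k} :
    IsPointwiseLeftKan s (HPath.cons J p) H (η.hcomp ζ) ↔ IsPointwiseLeftKan s p H ζ :=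
  and_congr (IsLeftKan.hcomp_iff hη)
    ⟨fun h _ f J' γ hγ => (IsLeftKan.hcomp_iff hη).1
      ((h f J' γ hγ).congr (CellOf.precompLast_hcomp_cell η ζ γ)),
    fun h _ f J' γ hγ => ((IsLeftKan.hcomp_iff hη).2 (h f J' γ hγ)).congr
      (CellOf.precompLast_hcomp_cell η ζ γ).symm⟩

theorem vcomp_congr {f : C ⟶ A} {p : HorPath C E} {H : Hor E D} {g : D ⟶ B} {d : A ⟶ M}
    {J : HorPath A B} {l l' : B ⟶ M} {η : CellOf d J (HPath.nil M) l}
    {η' : CellOf d J (HPath.nil M) l'} (hη : IsLeftKan .weak η) (hη' : IsLeftKan .weak η')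
    {φ : CellOf f (p.snoc H) J g} (h : IsPointwiseLeftKan s p H (η.vcomp φ)) :
    IsPointwiseLeftKan s p H (η'.vcomp φ) :=
  ⟨hη.vcomp_congr hη' h.1, fun k J' γ hγ =>
    (hη.vcomp_congr hη' ((h.2 k J' γ hγ).congr (CellOf.precompLast_vcomp_cell φ γ η))).congr
      (CellOf.precompLast_vcomp_cell φ γ η').symm⟩

end IsPointwiseLeftKan

/-- Cartesian nullary cells restrict to cartesian nullary cells. -/
theorem IsCartesian.precompLast {A B B' P : 𝒦} {y : A ⟶ P} {K : Hor A B} {l : B ⟶ P}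
    {η : CellOf y (HPath.single K) (HPath.nil P) l} (hη : IsCartesian η) {f : B' ⟶ B}
    {K' : Hor A B'} {γ : CellOf (𝟙 A) (HPath.single K') (HPath.single K) f}
    (hγ : IsCartesian γ) :
    IsCartesian (CellOf.precompLast (p := HPath.nil A) (J' := K') η γ) :=
  IsCartesian.congr (ψ' := CellOf.precompLast (p := HPath.nil A) (J' := K') η γ) (hη.vcomp hγ) rfl

theorem IsDense.isLeftKan {A B P : 𝒦} {y : A ⟶ P} (hy : IsDense y) {K : Hor A B}
    {l : B ⟶ P} {η : CellOf y (HPath.single K) (HPath.nil P) l} (hη : IsCartesian η) :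
    IsLeftKan s η :=
  IsLeftKan.of_full (hy K l η hη)

/-- Density applies to every restriction of `η`, as these are again cartesian. -/
theorem IsDense.isPointwiseLeftKan {A B P : 𝒦} {y : A ⟶ P} (hy : IsDense y) {K : Hor A B}
    {l : B ⟶ P} {η : CellOf y (HPath.single K) (HPath.nil P) l} (hη : IsCartesian η) :
    IsPointwiseLeftKan s (HPath.nil A) K η :=
  ⟨hy.isLeftKan hη, fun _ _ _ hγ => IsDense.isLeftKan hy (hη.precompLast hγ)⟩

theorem IsYoneda.isDense {A P : 𝒦} {y : A ⟶ P} (hy : IsYoneda y) : IsDense y := hy.1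

/-! ### Sufficient conditions for exactness -/

theorem IsRightCocartesianFor.isLeftExact {A C D M : 𝒦} {f : A ⟶ C} {J : HorPath A D}
    {K : HorPath C D} {φ : CellOf f J K (𝟙 D)}
    (hφ : IsRightCocartesianFor 0 s (CellPath.of φ)) (d : C ⟶ M) : IsLeftExact s d φ :=
  fun _ _ hη => hη.vcomp_of_factorsThrough fun H hH k =>
    isRightCocartesianFor_iff.1 hφ (CellPath.ids H) hH.extension_ids d k (HPath.nil M) rfl

/-- Exactness involves only nullary cells with vertical source `y`. With vertical target `k` these
are unary cells into `P(y, k)`, or unary cells into the companion with vertical target `k`; either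
restriction can replace horizontal units. -/
theorem IsRightUnaryCocartesian.isLeftExact {A C D P : 𝒦} {y : C ⟶ P}
    (hy : AdmitsNullaryRestrictions y ∨ HasCompanion y) {f : A ⟶ C} {J : HorPath A D}
    {K : HorPath C D} {φ : CellOf f J K (𝟙 D)} (hφ : IsRightUnaryCocartesian s φ) :
    IsLeftExact s y φ := by
  intro l η hη
  refine hη.vcomp_of_factorsThrough fun {X} H hH k => ?_
  have hf := fun {F : 𝒦} (k' : X ⟶ F) (N : Hor C F) =>
    isRightCocartesianFor_iff.1 hφ (CellPath.ids H) hH.extension_ids (𝟙 C) k' (HPath.single N) rfl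
  rcases hy with hy | ⟨N, ψ, hψ⟩
  · obtain ⟨N, ψ, hψ⟩ := hy k
    simpa using FactorsThrough.of_cartesian hψ (hf (𝟙 X) N)
  · simpa using FactorsThrough.of_cartesian hψ (hf k N)

/-- If `η ∘ φ` is left Kan for a cartesian nullary cell `η` into the target of a Yoneda morphism
then `φ` is unary-cocartesian. -/
theorem IsYoneda.isRightUnaryCocartesian (hL : HasLeftRestrictions 𝒦) {A C D P : 𝒦} {y : C ⟶ P}
    (hy : IsYoneda y) {f : A ⟶ C} {J : HorPath A D} {K : Hor C D}
    {φ : CellOf f J (HPath.single K) (𝟙 D)} {l : D ⟶ P}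
    {η : CellOf y (HPath.single K) (HPath.nil P) l} (hη : IsCartesian η)
    (h : IsLeftKan s (η.vcomp φ)) : IsRightUnaryCocartesian s φ := by
  refine isRightCocartesianFor_iff.2 fun ζs hζ => isWeaklyCocartesian_iff.2 fun {X F} a k L hLn => ?_
  obtain ⟨N, rfl⟩ := HPath.exists_eq_single L hLn
  -- Cells into `N` with vertical source `a` become cells into `N(a, id)` with trivial vertical
  -- source. As `N(a, id)` is some `P(y, l')`, these become nullary cells with vertical source `y`.
  obtain ⟨N', ρ, hρ⟩ := hL a N
  obtain ⟨l', ψ, hψ⟩ := hy.2 N'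
  have key := (IsDense.isLeftKan hy.isDense hη).factorsThrough_of_vcomp h hζ (k ≫ l')
  rw [← Category.id_comp y] at key
  simpa using (key.to_cartesian hψ).of_cartesian hρ

theorem exists_isRestrictionOf {A C D E Y : 𝒦} {a : A ⟶ C} {p : HorPath A E} {H : Hor E D}
    {K : Hor C D} (φ : CellOf a (p.snoc H) (HPath.single K) (𝟙 D)) {f : Y ⟶ D} {H' : Hor E Y}
    {K' : Hor C Y} {γ : CellOf (𝟙 E) (HPath.single H') (HPath.single H) f}
    {κ : CellOf (𝟙 C) (HPath.single K') (HPath.single K) f} (hγ : IsCartesian γ)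
    (hκ : IsCartesian κ) :
    ∃ φ' : CellOf a (p.snoc H') (HPath.single K') (𝟙 Y), IsRestrictionOf φ γ κ φ' := by
  obtain ⟨φ', e⟩ := hκ.exists_lift (h := a) (k := 𝟙 Y) (φ.precompLast γ)
    (Category.comp_id a).symm ((Category.comp_id f).trans (Category.id_comp f).symm)
  exact ⟨φ', hγ, hκ, e.symm⟩

/-- Restriction of `η ∘ φ` is the restriction of `η` composed with `φ'`; this reduces pointwise
exactness of `φ` to exactness of each `φ'`. -/
theorem IsRestrictionOf.vcomp_cell {A C D E Y M : 𝒦} {a : A ⟶ C} {p : HorPath A E} {H : Hor E D}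
    {K : Hor C D} {φ : CellOf a (p.snoc H) (HPath.single K) (𝟙 D)} {f : Y ⟶ D} {H' : Hor E Y}
    {K' : Hor C Y} {γ : CellOf (𝟙 E) (HPath.single H') (HPath.single H) f}
    {κ : CellOf (𝟙 C) (HPath.single K') (HPath.single K) f}
    {φ' : CellOf a (p.snoc H') (HPath.single K') (𝟙 Y)} (h : IsRestrictionOf φ γ κ φ')
    {d : C ⟶ M} {l : D ⟶ M} (η : CellOf d (HPath.single K) (HPath.nil M) l) :
    ((η.vcomp φ).precompLast γ).cell =
      (CellOf.vcomp (CellOf.precompLast (p := HPath.nil C) η κ) φ').cell :=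
  (CellOf.precompLast_vcomp_cell φ γ η).trans
    ((CellOf.vcomp_cell_congr (φ' := κ.vcomp φ') rfl h.2.2).trans
      ((CellOf.vcomp_assoc_cell η κ φ').trans (CellOf.vcomp_cell_congr rfl rfl)))

theorem CellPath.ids_append_hid {A B C : 𝒦} (p : HorPath A B) (H : Hor B C) :
    (CellPath.ids p).append (CellPath.of (hid H)) = CellPath.ids (p.snoc H) := by
  induction p with
  | nil => rfl
  | cons J p ih => exact congrArg (CellPath.cons _ _ _) (ih H)

/-- The case `f = id`: right pointwise cocartesianness, stated for the factorisations alone, thereby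
covers `φ` itself. -/
theorem isRestrictionOf_hid {A C D E : 𝒦} {a : A ⟶ C} {p : HorPath A E} {H : Hor E D}
    {K : Hor C D} (φ : CellOf a (p.snoc H) (HPath.single K) (𝟙 D)) :
    IsRestrictionOf φ (hid H) (hid K) φ := by
  refine ⟨isCartesian_hid H, isCartesian_hid K, Eq.trans ?_
    (AugmentedVirtualDoubleCategory.compose_hid φ).symm⟩
  refine (compose_congr ?_ rfl _ ?_).trans (ids_comp_cell φ)
  · rw [← CellPath.ids_append_hid]
    exact .refl _
  · exact (CellPath.tgt_ids _).trans φ.src_eq.symm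

theorem IsLeftExact.isPointwiseLeftExact {A C D E M : 𝒦} {d : C ⟶ M} {a : A ⟶ C}
    {p : HorPath A E} {H : Hor E D} {K : Hor C D}
    {φ : CellOf a (p.snoc H) (HPath.single K) (𝟙 D)} (hφ : IsLeftExact s d φ)
    (h : ∀ {Y : 𝒦} (f : Y ⟶ D), HasRestriction (𝟙 E) (HPath.single H) f →
      HasRestriction (𝟙 C) (HPath.single K) f ∧
        ∀ (H' : Hor E Y) (K' : Hor C Y)
          (γ : CellOf (𝟙 E) (HPath.single H') (HPath.single H) f)
          (κ : CellOf (𝟙 C) (HPath.single K') (HPath.single K) f)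
          (φ' : CellOf a (p.snoc H') (HPath.single K') (𝟙 Y)),
          IsRestrictionOf φ γ κ φ' → IsLeftExact s d φ') :
    IsPointwiseLeftExact s d p H φ := by
  refine fun l η hη => ⟨hφ l η hη.1, fun f H' γ hγ => ?_⟩
  obtain ⟨⟨K', κ, hκ⟩, h'⟩ := h f ⟨H', γ, hγ⟩
  obtain ⟨φ', hr⟩ := exists_isRestrictionOf φ hγ hκ
  exact (h' H' K' γ κ φ' hr _ _ (hη.2 f K' κ hκ)).congr (hr.vcomp_cell η).symm

theorem IsCocartesian.isRightCocartesian {A B C D : 𝒦} {f : A ⟶ C} {J : HorPath A B}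
    {K : HorPath C D} {g : B ⟶ D} {φ : CellOf f J K g} (hφ : IsCocartesian φ) :
    IsRightCocartesian s φ := by
  have h : ∀ {Y Z : 𝒦} {k : Y ⟶ Z} (ζs : CellPath g k), s.AllowsExtension ζs →
      IsWeaklyCocartesian 0 ((CellPath.of φ).append ζs) ∧
        IsWeaklyCocartesian 1 ((CellPath.of φ).append ζs) := fun ζs hζ => by
    cases hζ with
    | nil => exact hφ (CellPath.nil f) (CellPath.nil g) .nil .nil
    | full hζ => exact hφ (CellPath.nil f) ζs .nil hζ
  exact ⟨isRightCocartesianFor_iff.2 fun ζs hζ => (h ζs hζ).1,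
    isRightCocartesianFor_iff.2 fun ζs hζ => (h ζs hζ).2⟩

theorem IsRightUnaryCocartesian.isRightCocartesian (hU : IsUnital 𝒦) {A B C D : 𝒦} {f : A ⟶ C}
    {J : HorPath A B} {K : HorPath C D} {g : B ⟶ D} {φ : CellOf f J K g}
    (hφ : IsRightUnaryCocartesian s φ) : IsRightCocartesian s φ :=
  ⟨IsRightCocartesianFor.nullary_of_isUnital hU hφ, hφ⟩

section PointwiseCells

variable {A C D E : 𝒦} {a : A ⟶ C} {p : HorPath A E} {H : Hor E D} {K : Hor C D}
  {φ : CellOf a (p.snoc H) (HPath.single K) (𝟙 D)}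

/-- The hypothesis on `K` supplies the existence of restrictions, which right pointwise
cocartesianness presupposes rather than asserts. -/
theorem IsPointwiseCocartesian.isPointwiseRightCocartesian
    (hφ : IsPointwiseCocartesian p H φ) (hK : HasRightRestrictionsOf K) :
    IsPointwiseRightCocartesian s p H φ :=
  ⟨IsCocartesian.isRightCocartesian (hφ _ _ _ _ _ _ (isRestrictionOf_hid φ)), fun f _ =>
    ⟨hK f, fun H' K' γ κ φ' h => IsCocartesian.isRightCocartesian (hφ f H' K' γ κ φ' h)⟩⟩

theorem IsPointwiseRightCocartesian.isPointwiseRightUnaryCocartesian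
    (hφ : IsPointwiseRightCocartesian s p H φ) : IsPointwiseRightUnaryCocartesian s p H φ :=
  ⟨hφ.1.2, fun f hf =>
    ⟨(hφ.2 f hf).1, fun H' K' γ κ φ' h => ((hφ.2 f hf).2 H' K' γ κ φ' h).2⟩⟩

theorem IsPointwiseRightUnaryCocartesian.isPointwiseRightCocartesian (hU : IsUnital 𝒦)
    (hφ : IsPointwiseRightUnaryCocartesian s p H φ) : IsPointwiseRightCocartesian s p H φ :=
  ⟨hφ.1.isRightCocartesian hU, fun f hf => ⟨(hφ.2 f hf).1, fun H' K' γ κ φ' h =>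
    ((hφ.2 f hf).2 H' K' γ κ φ' h).isRightCocartesian hU⟩⟩

theorem IsPointwiseRightCocartesian.isPointwiseLeftExact {M : 𝒦}
    (hφ : IsPointwiseRightCocartesian s p H φ) (d : C ⟶ M) : IsPointwiseLeftExact s d p H φ :=
  (hφ.1.1.isLeftExact d).isPointwiseLeftExact fun f hf => ⟨(hφ.2 f hf).1,
    fun H' K' γ κ φ' h => ((hφ.2 f hf).2 H' K' γ κ φ' h).1.isLeftExact d⟩

theorem IsPointwiseRightUnaryCocartesian.isPointwiseLeftExact {P : 𝒦} {y : C ⟶ P}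
    (hy : AdmitsNullaryRestrictions y ∨ HasCompanion y)
    (hφ : IsPointwiseRightUnaryCocartesian s p H φ) : IsPointwiseLeftExact s y p H φ :=
  (hφ.1.isLeftExact hy).isPointwiseLeftExact fun f hf => ⟨(hφ.2 f hf).1,
    fun H' K' γ κ φ' h => ((hφ.2 f hf).2 H' K' γ κ φ' h).isLeftExact hy⟩

/-- It suffices to use exactness against the one cartesian cell that represents `K`, left Kan by
density. -/
theorem IsLeftExact.isRightUnaryCocartesian (hL : HasLeftRestrictions 𝒦) {P : 𝒦} {y : C ⟶ P}
    (hy : IsYoneda y) {J : HorPath A D} {φ : CellOf a J (HPath.single K) (𝟙 D)}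
    (hφ : IsLeftExact s y φ) : IsRightUnaryCocartesian s φ := by
  obtain ⟨l, η, hη⟩ := hy.2 K
  exact hy.isRightUnaryCocartesian hL hη (hφ l η (IsDense.isLeftKan hy.isDense hη))

theorem IsPointwiseLeftExact.isPointwiseRightUnaryCocartesian (hL : HasLeftRestrictions 𝒦)
    {P : 𝒦} {y : C ⟶ P} (hy : IsYoneda y) (hK : HasRightRestrictionsOf K)
    (hφ : IsPointwiseLeftExact s y p H φ) : IsPointwiseRightUnaryCocartesian s p H φ := by
  obtain ⟨l, η, hη⟩ := hy.2 K
  have h := hφ l η (IsDense.isPointwiseLeftKan hy.isDense hη)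
  refine ⟨hy.isRightUnaryCocartesian hL hη h.1, fun f _ => ⟨hK f, fun H' K' γ κ φ' hr => ?_⟩⟩
  exact hy.isRightUnaryCocartesian hL (hη.precompLast hr.2.1)
    ((h.2 f H' γ hr.1).congr (hr.vcomp_cell η))

end PointwiseCells

/-! ### Exact cells and left Kan extensions -/

section Extension

variable {A B E D P : 𝒦} {J : Hor A B} {p : HorPath B E} {H : Hor E D} {y : A ⟶ P}
  {Jc : B ⟶ P} {cartJ : CellOf y (HPath.single J) (HPath.nil P) Jc}

/-- Peel `cartJ` off the left Kan cell `η ∘ φ`; what remains is left Kan by the pasting lemma. -/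
theorem IsLeftExact.leftKanExtensionExists (hy : IsYoneda y) (hJ : IsCartesian cartJ)
    {q : HorPath B D} {K : Hor A D} {φ : HorCell (HPath.cons J q) K}
    (hφ : IsLeftExact s y φ) : LeftKanExtensionExists s Jc q := by
  obtain ⟨l, η, hη⟩ := hy.2 K
  have hJk : IsLeftKan .full cartJ := IsDense.isLeftKan (s := .full) hy.isDense hJ
  obtain ⟨ζ, e⟩ := (hJk q).exists_fac (η.vcomp φ) (Category.id_comp y) rfl
  exact ⟨_, ζ, (IsLeftKan.hcomp_iff hJk).1
    ((hφ l η (IsDense.isLeftKan hy.isDense hη)).congr e.symm)⟩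

theorem IsPointwiseLeftExact.pointwiseLeftKanExtensionExists (hy : IsYoneda y)
    (hJ : IsCartesian cartJ) {K : Hor A D} {φ : HorCell (HPath.cons J (p.snoc H)) K}
    (hφ : IsPointwiseLeftExact s y (HPath.cons J p) H φ) :
    PointwiseLeftKanExtensionExists s Jc p H := by
  obtain ⟨l, η, hη⟩ := hy.2 K
  have hJk : IsLeftKan .full cartJ := IsDense.isLeftKan (s := .full) hy.isDense hJ
  obtain ⟨ζ, e⟩ := (hJk (p.snoc H)).exists_fac (η.vcomp φ) (Category.id_comp y) rfl
  exact ⟨_, ζ, (IsPointwiseLeftKan.hcomp_iff hJk).1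
    ((hφ l η (IsDense.isPointwiseLeftKan hy.isDense hη)).congr e.symm)⟩

/-- The target is `K = P(y, l)` for the Kan extension `l`, and `φ` corresponds to `cartJ ⊙ ζ`.
Exactness holds against the cartesian `η`, hence against all Kan cells out of `K`. -/
theorem IsDense.exists_isLeftExact (hy : IsDense y) (hN : AdmitsNullaryRestrictions y)
    (hJ : IsCartesian cartJ) {q : HorPath B D} (h : LeftKanExtensionExists s Jc q) :
    ∃ (K : Hor A D) (φ : HorCell (HPath.cons J q) K), IsLeftExact s y φ := by
  obtain ⟨l, ζ, hζ⟩ := h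
  have hJk : IsLeftKan .full cartJ := IsDense.isLeftKan (s := .full) hy hJ
  obtain ⟨K, η, hη⟩ := hN l
  obtain ⟨φ, e⟩ := hη.exists_lift (h := 𝟙 A) (k := 𝟙 D) (cartJ.hcomp ζ)
    (Category.id_comp y).symm (Category.id_comp l).symm
  exact ⟨K, φ, fun _ _ hθ => IsLeftKan.vcomp_congr (hy.isLeftKan hη) hθ.toWeak
    (((IsLeftKan.hcomp_iff hJk).2 hζ).congr e.symm)⟩

theorem IsDense.exists_isPointwiseLeftExact (hy : IsDense y) (hN : AdmitsNullaryRestrictions y)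
    (hJ : IsCartesian cartJ) (h : PointwiseLeftKanExtensionExists s Jc p H) :
    ∃ (K : Hor A D) (φ : HorCell (HPath.cons J (p.snoc H)) K),
      IsPointwiseLeftExact s y (HPath.cons J p) H φ := by
  obtain ⟨l, ζ, hζ⟩ := h
  have hJk : IsLeftKan .full cartJ := IsDense.isLeftKan (s := .full) hy hJ
  obtain ⟨K, η, hη⟩ := hN l
  obtain ⟨φ, e⟩ := hη.exists_lift (h := 𝟙 A) (k := 𝟙 D) (cartJ.hcomp ζ)
    (Category.id_comp y).symm (Category.id_comp l).symm
  exact ⟨K, φ, fun _ _ hθ => IsPointwiseLeftKan.vcomp_congr (hy.isLeftKan hη) hθ.1.toWeak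
    (((IsPointwiseLeftKan.hcomp_iff hJk).2 hζ).congr e.symm)⟩

/-- Pointwise left Kan extension along the companion of a Yoneda morphism gives pointwise left
Kan extension along all horizontal morphisms. -/
theorem IsYoneda.pointwiseLeftKanExtensionExists {B Q X M : 𝒦} {yB : B ⟶ Q} (hyB : IsYoneda yB)
    {S : Hor B Q} {cartS : CellOf yB (HPath.single S) (HPath.nil Q) (𝟙 Q)}
    (hS : IsCartesian cartS) {d : B ⟶ M} (h : PointwiseLeftKanExtensionExists s d (HPath.nil B) S)
    (H : Hor B X) : PointwiseLeftKanExtensionExists s d (HPath.nil B) H := by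
  obtain ⟨l, ζ, hζ⟩ := h
  obtain ⟨b, θ, hθ⟩ := hyB.2 H
  -- `H` is the restriction of `Q` along `yB` and `b`, so it is the restriction `S(id, b)` of the
  -- companion, with cartesian cell `γ`.
  obtain ⟨γ, e⟩ := hS.exists_lift (h := 𝟙 B) (k := b) θ (Category.id_comp yB).symm
    (Category.comp_id b).symm
  have hγ : IsCartesian γ := hS.of_vcomp (IsCartesian.congr hθ e.symm)
  refine ⟨b ≫ l, ζ.precompLast γ, hζ.2 b H γ hγ, fun f H' γ' hγ' => ?_⟩
  -- A restriction of `H` along `f` is a restriction of `S` along `f ≫ b`; the cast turns the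
  -- vertical source `𝟙 B ≫ 𝟙 B` into `𝟙 B`.
  refine (hζ.2 (f ≫ b) H' ((γ.vcomp γ').cast (Category.comp_id _) rfl rfl rfl)
    (IsCartesian.congr (ψ' := (γ.vcomp γ').cast (Category.comp_id _) rfl rfl rfl)
      (hγ.vcomp hγ') rfl)).congr ?_
  exact (CellOf.vcomp_cell_congr (ψ := ζ)
    (φ := (γ.vcomp γ').cast (Category.comp_id _) rfl rfl rfl) (φ' := γ.vcomp γ') rfl rfl).trans
    (CellOf.vcomp_assoc_cell ζ γ γ')

end Extension

end AVDC

end Pointwise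

/-! ### The theorem -/

theorem mainTheorem12 {𝒦 : Type u} [AugmentedVirtualDoubleCategory.{t, w, v} 𝒦]
    {A B E D P : 𝒦} (J : Hor A B) (p : HorPath B E) (Hn : Hor E D)
    (y : A ⟶ P) (hy : IsYoneda y)
    (Jc : B ⟶ P) (cartJ : CellOf y (HPath.single J) (HPath.nil P) Jc) (hJ : IsCartesian cartJ)
    (s : Strength) :
    -- (a) ⇒ (b)
    ((∃ (K : Hor A D) (φ : HorCell (HPath.cons J (p.snoc Hn)) K), IsCocartesian φ) →
      ∃ (K : Hor A D) (φ : HorCell (HPath.cons J (p.snoc Hn)) K),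
        IsRightCocartesian s φ) ∧
    -- (b) ⇒ (c)
    ((∃ (K : Hor A D) (φ : HorCell (HPath.cons J (p.snoc Hn)) K),
        IsRightCocartesian s φ) →
      ∃ (K : Hor A D) (φ : HorCell (HPath.cons J (p.snoc Hn)) K),
        IsRightUnaryCocartesian s φ) ∧
    -- (b) ⇒ (d)
    ((∃ (K : Hor A D) (φ : HorCell (HPath.cons J (p.snoc Hn)) K),
        IsRightCocartesian s φ) →
      ∃ (K : Hor A D) (φ : HorCell (HPath.cons J (p.snoc Hn)) K),
        IsLeftExact s y φ) ∧
    -- (d) ⇒ (e)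
    ((∃ (K : Hor A D) (φ : HorCell (HPath.cons J (p.snoc Hn)) K),
        IsLeftExact s y φ) →
      LeftKanExtensionExists s Jc (p.snoc Hn)) ∧
    -- (b) ⇔ (c)
    (IsUnital 𝒦 →
      ((∃ (K : Hor A D) (φ : HorCell (HPath.cons J (p.snoc Hn)) K),
          IsRightCocartesian s φ) ↔
        ∃ (K : Hor A D) (φ : HorCell (HPath.cons J (p.snoc Hn)) K),
          IsRightUnaryCocartesian s φ)) ∧
    -- (d) ⇒ (c)
    (HasLeftRestrictions 𝒦 →
      (∃ (K : Hor A D) (φ : HorCell (HPath.cons J (p.snoc Hn)) K),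
        IsLeftExact s y φ) →
      ∃ (K : Hor A D) (φ : HorCell (HPath.cons J (p.snoc Hn)) K),
        IsRightUnaryCocartesian s φ) ∧
    -- (c) ⇔ (d)
    (HasLeftRestrictions 𝒦 → (AdmitsNullaryRestrictions y ∨ HasCompanion y) →
      ((∃ (K : Hor A D) (φ : HorCell (HPath.cons J (p.snoc Hn)) K),
          IsRightUnaryCocartesian s φ) ↔
        ∃ (K : Hor A D) (φ : HorCell (HPath.cons J (p.snoc Hn)) K),
          IsLeftExact s y φ)) ∧
    -- (d) ⇔ (e)
    (AdmitsNullaryRestrictions y →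
      ((∃ (K : Hor A D) (φ : HorCell (HPath.cons J (p.snoc Hn)) K),
          IsLeftExact s y φ) ↔
        LeftKanExtensionExists s Jc (p.snoc Hn))) ∧
    -- pointwise (a) ⇒ (b)
    ((∃ (K : Hor A D) (φ : HorCell (HPath.cons J (p.snoc Hn)) K),
        IsPointwiseCocartesian (HPath.cons J p) Hn φ ∧ HasRightRestrictionsOf K) →
      ∃ (K : Hor A D) (φ : HorCell (HPath.cons J (p.snoc Hn)) K),
        IsPointwiseRightCocartesian s (HPath.cons J p) Hn φ) ∧
    -- pointwise (b) ⇒ (c)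
    ((∃ (K : Hor A D) (φ : HorCell (HPath.cons J (p.snoc Hn)) K),
        IsPointwiseRightCocartesian s (HPath.cons J p) Hn φ) →
      ∃ (K : Hor A D) (φ : HorCell (HPath.cons J (p.snoc Hn)) K),
        IsPointwiseRightUnaryCocartesian s (HPath.cons J p) Hn φ) ∧
    -- pointwise (b) ⇒ (d)
    ((∃ (K : Hor A D) (φ : HorCell (HPath.cons J (p.snoc Hn)) K),
        IsPointwiseRightCocartesian s (HPath.cons J p) Hn φ) →
      ∃ (K : Hor A D) (φ : HorCell (HPath.cons J (p.snoc Hn)) K),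
        IsPointwiseLeftExact s y (HPath.cons J p) Hn φ) ∧
    -- pointwise (d) ⇒ (e)
    ((∃ (K : Hor A D) (φ : HorCell (HPath.cons J (p.snoc Hn)) K),
        IsPointwiseLeftExact s y (HPath.cons J p) Hn φ) →
      PointwiseLeftKanExtensionExists s Jc p Hn) ∧
    -- pointwise (b) ⇔ (c)
    (IsUnital 𝒦 →
      ((∃ (K : Hor A D) (φ : HorCell (HPath.cons J (p.snoc Hn)) K),
          IsPointwiseRightCocartesian s (HPath.cons J p) Hn φ) ↔
        ∃ (K : Hor A D) (φ : HorCell (HPath.cons J (p.snoc Hn)) K),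
          IsPointwiseRightUnaryCocartesian s (HPath.cons J p) Hn φ)) ∧
    -- pointwise (d) ⇒ (c)
    (HasLeftRestrictions 𝒦 → ∀ K : Hor A D, HasRightRestrictionsOf K →
      (∃ φ : HorCell (HPath.cons J (p.snoc Hn)) K,
        IsPointwiseLeftExact s y (HPath.cons J p) Hn φ) →
      ∃ φ : HorCell (HPath.cons J (p.snoc Hn)) K,
        IsPointwiseRightUnaryCocartesian s (HPath.cons J p) Hn φ) ∧
    -- pointwise (c) ⇔ (d)
    (HasLeftRestrictions 𝒦 → (AdmitsNullaryRestrictions y ∨ HasCompanion y) →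
      ∀ K : Hor A D, HasRightRestrictionsOf K →
        ((∃ φ : HorCell (HPath.cons J (p.snoc Hn)) K,
            IsPointwiseRightUnaryCocartesian s (HPath.cons J p) Hn φ) ↔
          ∃ φ : HorCell (HPath.cons J (p.snoc Hn)) K,
            IsPointwiseLeftExact s y (HPath.cons J p) Hn φ)) ∧
    -- pointwise (d) ⇔ (e)
    (AdmitsNullaryRestrictions y →
      ((∃ (K : Hor A D) (φ : HorCell (HPath.cons J (p.snoc Hn)) K),
          IsPointwiseLeftExact s y (HPath.cons J p) Hn φ) ↔
        PointwiseLeftKanExtensionExists s Jc p Hn)) ∧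
    -- the last assertion, on paths of length one
    (∀ {Q X : 𝒦} (yB : B ⟶ Q) (_ : IsYoneda yB) (S : Hor B Q)
      (cartS : CellOf yB (HPath.single S) (HPath.nil Q) (𝟙 Q)) (_ : IsCartesian cartS)
      (H₁ : Hor B X),
      PointwiseLeftKanExtensionExists s Jc (HPath.nil B) S →
        PointwiseLeftKanExtensionExists s Jc (HPath.nil B) H₁) := by
  refine ⟨?_, ?_, ?_, ?_, ?_, ?_, ?_, ?_, ?_, ?_, ?_, ?_, ?_, ?_, ?_, ?_, ?_⟩
  · exact fun ⟨K, φ, h⟩ => ⟨K, φ, IsCocartesian.isRightCocartesian h⟩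
  · exact fun ⟨K, φ, h⟩ => ⟨K, φ, h.2⟩
  · exact fun ⟨K, φ, h⟩ => ⟨K, φ, h.1.isLeftExact y⟩
  · exact fun ⟨_, _, h⟩ => h.leftKanExtensionExists hy hJ
  · exact fun hU => ⟨fun ⟨K, φ, h⟩ => ⟨K, φ, h.2⟩,
      fun ⟨K, φ, h⟩ => ⟨K, φ, h.isRightCocartesian hU⟩⟩
  · exact fun hL ⟨K, φ, h⟩ => ⟨K, φ, h.isRightUnaryCocartesian hL hy⟩
  · exact fun hL hN => ⟨fun ⟨K, φ, h⟩ => ⟨K, φ, h.isLeftExact hN⟩,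
      fun ⟨K, φ, h⟩ => ⟨K, φ, h.isRightUnaryCocartesian hL hy⟩⟩
  · exact fun hN => ⟨fun ⟨_, _, h⟩ => h.leftKanExtensionExists hy hJ,
      IsDense.exists_isLeftExact hy.isDense hN hJ⟩
  · exact fun ⟨K, φ, h, hK⟩ => ⟨K, φ, h.isPointwiseRightCocartesian hK⟩
  · exact fun ⟨K, φ, h⟩ => ⟨K, φ, h.isPointwiseRightUnaryCocartesian⟩
  · exact fun ⟨K, φ, h⟩ => ⟨K, φ, h.isPointwiseLeftExact y⟩
  · exact fun ⟨_, _, h⟩ => h.pointwiseLeftKanExtensionExists hy hJ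
  · exact fun hU => ⟨fun ⟨K, φ, h⟩ => ⟨K, φ, h.isPointwiseRightUnaryCocartesian⟩,
      fun ⟨K, φ, h⟩ => ⟨K, φ, h.isPointwiseRightCocartesian hU⟩⟩
  · exact fun hL _ hK ⟨φ, h⟩ => ⟨φ, h.isPointwiseRightUnaryCocartesian hL hy hK⟩
  · exact fun hL hN _ hK => ⟨fun ⟨φ, h⟩ => ⟨φ, h.isPointwiseLeftExact hN⟩,
      fun ⟨φ, h⟩ => ⟨φ, h.isPointwiseRightUnaryCocartesian hL hy hK⟩⟩
  · exact fun hN => ⟨fun ⟨_, _, h⟩ => h.pointwiseLeftKanExtensionExists hy hJ,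
      IsDense.exists_isPointwiseLeftExact hy.isDense hN hJ⟩
  · exact fun _ hyB _ _ hS H₁ h => hyB.pointwiseLeftKanExtensionExists hS h H₁
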